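/- All graphs are finite and may have loops and parallel edges unless called simple. A \emph{biased graph} $(G,\mathcal B)$ is a graph $G$ with a set $\mathcal B$ of cycles of $G$ (the \emph{balanced} cycles) such that no theta subgraph of $G$ (two distinct vertices $x,y$ together with three internally disjoint $x$--$y$ paths) has exactly two of its three cycles in $\mathcal B$. For a group $\Gamma$, $(G,\mathcal B)$ is \emph{$\Gamma$-labellable} if there are an orientation of $G$ and a map $\phi:E(G)\to\Gamma$ such that $\mathcal B$ is exactly the set of cycles $C$ for which a simple closed walk $e_1,\dots,e_\ell$ around $C$ satisfies $\prod_{i=1}^{\ell}\phi(e_i)^{\epsilon_i}=1$, where $\epsilon_i=1$ if $e_i$ is traversed forward and $\epsilon_i=-1$ if it is traversed backward; it is \emph{group-labellable} if it is $\Gamma$-labellable for some group $\Gamma$. Deleting an edge $e$ gives $(G\setminus e,\{C\in\mathcal B: e\notin E(C)\})$. Contracting a non-loop edge $e$ gives $G/e$, where a cycle $C$ of $G/e$ is balanced if $C\in\mathcal B$ or $E(C)\cup\{e\}$ is the edge set of a cycle in $\mathcal B$. \textbf{Theorem.} Let $t$ be a positive integer and let $G$ be a finite simple graph embedded in the plane,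 with a colouring of its vertices by $t$ colours, such that (1) $G$ is a subdivision of a $3$-connected graph (on at least four vertices); (2) every colour appears exactly once on every face, including the infinite face; (3) every cycle of $G$ of length at most $t$ is the boundary of a face. Let $\widetilde G$ be the graph obtained from $G$ by identifying each colour class to a single vertex (keeping all edges), and let $\mathcal B$ be the set of cycles of $\widetilde G$ whose edge sets are the boundaries of the finite faces of $G$. Then $(\widetilde G,\mathcal B)$ is a biased graph without loops, and it is not group-labellable. Moreover, for every edge $e$ of $\widetilde G$ and every infinite group $\Gamma$, both the biased graph obtained from $(\widetilde G,\mathcal B)$ by deleting $e$ and the one obtained by contracting $e$ are $\Gamma$-labellable. -/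

import Mathlib

open scoped Graph

/-! ### Walks, paths, cycles and theta subgraphs of multigraphs -/

namespace Graph

variable {α β α' β' : Type*}

/-- Walks in a multigraph, recording the edges that are traversed. -/
inductive Walk (G : Graph α β) : α → α → Type _
  | nil {u : α} (hu : u ∈ V(G)) : Walk G u u
  | cons {u v w : α} (e : β) (h : G.IsLink e u v) (p : Walk G v w) : Walk G u w

namespace Walk

variable {G : Graph α β}

/-- The sequence of edges of a walk. -/
def edges : {u v : α} → G.Walk u v → List β
  | _, _, nil _ => []
  | _, _, cons e _ p => e :: p.edges

/-- The sequence of vertices of a walk, both ends included. -/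
def support : {u v : α} → G.Walk u v → List α
  | u, _, nil _ => [u]
  | u, _, cons _ _ p => u :: p.support

/-- The set of edges of a walk. -/
def edgeSet {u v : α} (p : G.Walk u v) : Set β := {e | e ∈ p.edges}

/-- A path: no repeated vertex. -/
def IsPath {u v : α} (p : G.Walk u v) : Prop := p.support.Nodup

/-- A simple closed walk around a cycle: it is not trivial and, apart from the return to the
start, repeats neither an edge nor a vertex. A loop is a cycle of length one and two parallel
edges form a cycle of length two. -/
structure IsCycle {u : α} (p : G.Walk u u) : Prop where
  ne_nil : p.edges ≠ []
  edges_nodup : p.edges.Nodup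
  support_tail_nodup : p.support.tail.Nodup

/-- Two walks from `x` to `y` are internally disjoint if they have no common edge and no common
vertex other than `x` and `y`. -/
def InternallyDisjoint {x y : α} (p q : G.Walk x y) : Prop :=
  (∀ e ∈ p.edges, e ∉ q.edges) ∧ ∀ z ∈ p.support, z ∈ q.support → z = x ∨ z = y

end Walk

/-- `C` is the edge set of a cycle of `G`. Cycles are identified with their edge sets. -/
def IsCycleSet (G : Graph α β) (C : Set β) : Prop :=
  ∃ (u : α) (p : G.Walk u u), p.IsCycle ∧ p.edgeSet = C

/-! ### Biased graphs, group labellings and minors -/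

/-- `(G, 𝓑)` is a biased graph: `𝓑` is a set of cycles of `G`, and if two of the three cycles of a
theta subgraph belong to `𝓑`, then so does the third (the three paths may be taken in any
order). -/
structure IsBiased (G : Graph α β) (𝓑 : Set (Set β)) : Prop where
  isCycleSet : ∀ C ∈ 𝓑, G.IsCycleSet C
  theta : ∀ (x y : α) (p q r : G.Walk x y), x ≠ y → p.IsPath → q.IsPath → r.IsPath →
    p.InternallyDisjoint q → p.InternallyDisjoint r → q.InternallyDisjoint r →
    p.edgeSet ∪ q.edgeSet ∈ 𝓑 → p.edgeSet ∪ r.edgeSet ∈ 𝓑 → q.edgeSet ∪ r.edgeSet ∈ 𝓑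

/-- A group labelling: an orientation of the edges, given by the tail of each edge, together with
a label in `Γ` for every edge. -/
structure GroupLabelling (G : Graph α β) (Γ : Type*) where
  tail : E(G) → α
  inc_tail : ∀ e : E(G), G.Inc e (tail e)
  label : E(G) → Γ

open Classical in
/-- The value of a group labelling on a walk: the ordered product of the labels, inverted for the
edges that are traversed backward. (For a loop the direction of traversal is immaterial to
whether the cycle that it forms has value `1`; it is read as forward.) -/
noncomputable def Walk.gain {G : Graph α β} {Γ : Type*} [Group Γ] (φ : G.GroupLabelling Γ) :
    {u v : α} → G.Walk u v → Γ
  | _, _, .nil _ => 1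
  | u, _, .cons e h p =>
      (if u = φ.tail ⟨e, h.edge_mem⟩ then φ.label ⟨e, h.edge_mem⟩
        else (φ.label ⟨e, h.edge_mem⟩)⁻¹) * Walk.gain φ p

/-- The cycles around which some simple closed walk has value `1`. -/
def GroupLabelling.balanced {G : Graph α β} {Γ : Type*} [Group Γ] (φ : G.GroupLabelling Γ) :
    Set (Set β) :=
  {C | ∃ (u : α) (p : G.Walk u u), p.IsCycle ∧ p.edgeSet = C ∧ p.gain φ = 1}

/-- `(G, 𝓑)` is `Γ`-labellable. -/
def Labellable (G : Graph α β) (𝓑 : Set (Set β)) (Γ : Type*) [Group Γ] : Prop :=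
  ∃ φ : G.GroupLabelling Γ, φ.balanced = 𝓑

/-- The balanced cycles after deletion of `e` (the graph being `G.deleteEdges {e}`). -/
def deleteBalanced (𝓑 : Set (Set β)) (e : β) : Set (Set β) := {C ∈ 𝓑 | e ∉ C}

open Classical in
/-- Contraction of an edge `e` with ends `x ≠ y`: delete `e` and identify `y` with `x`. -/
noncomputable def contract (G : Graph α β) (e : β) (x y : α) : Graph α β :=
  (G.deleteEdges {e}).map (fun z => if z = y then x else z)

/-- The balanced cycles after contraction of an edge `e` with ends `x ≠ y`: the cycles `C` of the
contracted graph with `C ∈ 𝓑` or `C ∪ {e} ∈ 𝓑`. -/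
def contractBalanced (G : Graph α β) (𝓑 : Set (Set β)) (e : β) (x y : α) : Set (Set β) :=
  {C | (G.contract e x y).IsCycleSet C ∧ (C ∈ 𝓑 ∨ insert e C ∈ 𝓑)}

/-! ### Subdivisions and 3-connectivity -/

/-- A (loopless, possibly with parallel edges) graph is 3-connected if it has at least four
vertices and remains connected after removal of any at most two vertices. -/
structure IsThreeConnected (H : Graph α β) : Prop where
  loopless : H.Loopless
  four_le_card : 4 ≤ V(H).encard
  connected : ∀ X : Set α, X.encard ≤ 2 → ∀ x ∈ V(H) \ X, ∀ y ∈ V(H) \ X,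
    Nonempty ((H.deleteVerts X).Walk x y)

/-- `G` is a subdivision of the loopless graph `H`: the edges of `H` are replaced by internally
disjoint paths between their ends, and these make up the whole of `G`. -/
structure Subdivision (G : Graph α β) (H : Graph α' β') where
  /-- The position in `G` of a vertex of `H`. -/
  branch : α' → α
  branch_mem : ∀ x ∈ V(H), branch x ∈ V(G)
  branch_injOn : Set.InjOn branch V(H)
  /-- The two ends of an edge of `H`. -/
  left : E(H) → α'
  right : E(H) → α'
  isLink : ∀ f : E(H), H.IsLink f (left f) (right f)
  /-- The path that replaces an edge of `H`. -/
  path : ∀ f : E(H), G.Walk (branch (left f)) (branch (right f))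
  isPath : ∀ f, (path f).IsPath
  branch_mem_support : ∀ f, ∀ x ∈ V(H), branch x ∈ (path f).support → x = left f ∨ x = right f
  support_disjoint : ∀ f g, f ≠ g → ∀ v ∈ (path f).support, v ∈ (path g).support →
    ∃ x ∈ V(H), branch x = v
  edges_disjoint : ∀ f g, f ≠ g → ∀ e ∈ (path f).edges, e ∉ (path g).edges
  vertex_cover : ∀ v ∈ V(G), (∃ x ∈ V(H), branch x = v) ∨ ∃ f, v ∈ (path f).support
  edge_cover : ∀ e ∈ E(G), ∃ f, e ∈ (path f).edges

end Graph

/-! ### Plane embeddings -/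

/-- A rotation system: a cyclic order on the darts leaving each vertex. -/
structure RotationSystem {V : Type*} (G : SimpleGraph V) where
  /-- The next dart around the initial vertex. -/
  next : Equiv.Perm G.Dart
  fst_next : ∀ d, (next d).fst = d.fst
  sameCycle : ∀ d d' : G.Dart, d.fst = d'.fst → next.SameCycle d d'

namespace RotationSystem

variable {V : Type*} {G : SimpleGraph V} (R : RotationSystem G)

/-- Face tracing: from `d`, go to the terminal vertex of `d` and leave it by the dart that follows
the reverse of `d` in the rotation there. -/
def facePerm : Equiv.Perm G.Dart :=
  (SimpleGraph.Dart.symm_involutive (G := G)).toPerm.trans R.next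

/-- The faces are the orbits of face tracing. -/
def Face : Type _ := Quotient (Equiv.Perm.SameCycle.setoid R.facePerm)

/-- The face whose boundary walk traverses the dart `d`. -/
def face (d : G.Dart) : R.Face := Quotient.mk (Equiv.Perm.SameCycle.setoid R.facePerm) d

/-- The edges on the boundary of a face. -/
def boundary (F : R.Face) : Set (Sym2 V) := {e | ∃ d : G.Dart, R.face d = F ∧ d.edge = e}

end RotationSystem

/-- A connected graph with at least one edge embedded in the plane, in the usual combinatorial
description: a rotation system that satisfies Euler's formula for the sphere, `|V| - |E| + |F| = 2`,
and one face that is selected as the infinite face. -/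
structure PlaneEmbedding {V : Type*} (G : SimpleGraph V) extends RotationSystem G where
  connected : G.Connected
  euler : Nat.card V + Nat.card toRotationSystem.Face = Nat.card G.edgeSet + 2
  /-- The infinite face. -/
  outer : toRotationSystem.Face

/-- The edge sets of the boundaries of the finite faces. -/
def PlaneEmbedding.finiteFaces {V : Type*} {G : SimpleGraph V} (P : PlaneEmbedding G) :
    Set (Set (Sym2 V)) :=
  {C | ∃ F : P.Face, F ≠ P.outer ∧ C = P.boundary F}

/-- The multigraph obtained from `G` by identifying every colour class to a single vertex; its
edges are those of `G`. -/
def SimpleGraph.identifyColours {V : Type*} {t : ℕ} (G : SimpleGraph V) (col : V → Fin t) :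
    Graph (Fin t) (Sym2 V) :=
  (Graph.ofSimpleGraph G).map col

/-! By (2) the boundary walk of a face meets every colour once, so it becomes a spanning cycle of
length `t` of the identified graph. Two darts of one face whose end colours match also meet in `G`
(`facePerm_eq_of_link`), so a cycle of the identified graph with the edges of a face boundary runs
around that face (`link_and_sum`). 3-connectivity enters only through a vertex of degree at least
three, which makes the two sides of an edge, and the boundaries of two faces, different.

Biased: two balanced cycles of a theta would both be spanning, which leaves two faces whose
boundaries differ in a single edge. These two edges would be parallel in the simple graph `G`, so no
theta has two balanced cycles.

Not labellable: a labelling of a plane graph that is trivial around all finite faces comes from a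
potential (`exists_potential`), hence is trivial around the infinite face too, whose boundary is not
in `𝓑`.

Minors: a dart from `u` to `v` is labelled `(g u)⁻¹ * γ ^ ψ * g v` with `γ ≠ 1`, an antisymmetric
integer function `ψ` on darts and a generic potential `g`. By `exists_generic_potential`, a cycle
that enters a colour class at one vertex and leaves it at another has nontrivial value (after
contraction, the ends of the contracted edge count as one vertex). The remaining cycles come from
cycles of `G` of length at most `t`, so by (3) from faces, and have value `γ` to plus or minus the
sum of `ψ` over the face. It remains to find `ψ` with sum `0` on the surviving finite faces and `±1`
on the infinite face if that survives. After deletion, `ψ` is a dual flow between the infinite face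
and a destroyed one (`exists_flow`); after contraction only the faces at the contracted edge matter
(`exists_flow_avoiding`). -/

open scoped Graph

/-! ### Ordered products over initial segments -/

section RangeProd

variable {Γ : Type*} [Group Γ]

/-- The ordered product `F 0 * F 1 * ⋯ * F (n - 1)`. -/
def rangeProd (F : ℕ → Γ) (n : ℕ) : Γ := ((List.range n).map F).prod

@[simp] lemma rangeProd_zero (F : ℕ → Γ) : rangeProd F 0 = 1 := by simp [rangeProd]

lemma rangeProd_succ (F : ℕ → Γ) (n : ℕ) : rangeProd F (n + 1) = rangeProd F n * F n := by
  simp [rangeProd, List.range_succ]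

lemma rangeProd_congr {F F' : ℕ → Γ} {n : ℕ} (h : ∀ i < n, F i = F' i) :
    rangeProd F n = rangeProd F' n := by
  induction n with
  | zero => simp
  | succ n ih =>
    rw [rangeProd_succ, rangeProd_succ, h n (by omega), ih fun i hi => h i (by omega)]

lemma rangeProd_one (n : ℕ) : rangeProd (fun _ => (1 : Γ)) n = 1 := by
  simp [rangeProd]

/-- If two sequences agree except possibly at `j` and have the same product, they agree at `j`. -/
lemma eq_of_rangeProd_eq {F F' : ℕ → Γ} {n j : ℕ} (hj : j < n)
    (h : ∀ i < n, i ≠ j → F i = F' i) (hp : rangeProd F n = rangeProd F' n) : F j = F' j := by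
  induction n with
  | zero => omega
  | succ n ih =>
    rw [rangeProd_succ, rangeProd_succ] at hp
    rcases eq_or_ne j n with rfl | hne
    · rw [rangeProd_congr fun i hi => h i (by omega) (by omega)] at hp
      exact mul_left_cancel hp
    · rw [h n (by omega) hne.symm] at hp
      exact ih (by omega) (fun i hi => h i (by omega)) (mul_right_cancel hp)

/-- Regrouping a product of terms `a⁻¹ g b`. -/
lemma rangeProd_regroup (a b g : ℕ → Γ) (n : ℕ) :
    rangeProd (fun i => (a i)⁻¹ * g i * b i) n =
      (a 0)⁻¹ * rangeProd (fun i => g i * (b i * (a (i + 1))⁻¹)) n * a n := by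
  induction n with
  | zero => simp
  | succ n ih => rw [rangeProd_succ, rangeProd_succ, ih]; group

lemma rangeProd_zpow (γ : Γ) (s : ℕ → ℤ) (n : ℕ) :
    rangeProd (fun i => γ ^ s i) n = γ ^ ∑ i ∈ Finset.range n, s i := by
  induction n with
  | zero => simp
  | succ n ih => rw [rangeProd_succ, ih, Finset.sum_range_succ, zpow_add]

end RangeProd

/-! ### Generic assignments -/

/-- Given finitely many words in variables from a finite set such that every word depends
injectively on each variable of its nonempty support and on no other variable, there is an
assignment of the variables in an infinite group at which no word vanishes. -/
lemma exists_generic {V ι Γ : Type*} [Finite V] [Finite ι] [Group Γ] [Infinite Γ]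
    [DecidableEq V] (supp : ι → Set V) (word : ι → (V → Γ) → Γ)
    (hne : ∀ i, (supp i).Nonempty)
    (hindep : ∀ i, ∀ v ∉ supp i, ∀ h x, word i (Function.update h v x) = word i h)
    (hinj : ∀ i, ∀ v ∈ supp i, ∀ h, Function.Injective fun x => word i (Function.update h v x)) :
    ∃ h : V → Γ, ∀ i, word i h ≠ 1 := by
  -- Induction on the variables already chosen. Each of the finitely many words involving the next
  -- variable excludes at most one value for it, and `Γ` is infinite.
  have key : ∀ s : Finset V, ∃ h : V → Γ, ∀ i, supp i ⊆ s → word i h ≠ 1 := by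
    intro s
    induction s using Finset.induction_on with
    | empty =>
      refine ⟨fun _ => 1, fun i hi => ?_⟩
      obtain ⟨v, hv⟩ := hne i
      simpa using hi hv
    | insert v s hv ih =>
      obtain ⟨h, hh⟩ := ih
      have hfin : (⋃ i ∈ {i | v ∈ supp i},
          {x | word i (Function.update h v x) = 1}).Finite := by
        refine Set.Finite.biUnion (Set.toFinite _) fun i hi => ?_
        refine Set.Subsingleton.finite fun x hx y hy => hinj i v hi h ?_
        exact Eq.trans hx (Eq.symm hy)
      obtain ⟨x, -, hx⟩ := Set.infinite_univ.exists_notMem_finite hfin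
      refine ⟨Function.update h v x, fun i hi => ?_⟩
      by_cases hvi : v ∈ supp i
      · intro h1
        exact hx (Set.mem_biUnion (show i ∈ {i | v ∈ supp i} from hvi) h1)
      · rw [hindep i v hvi]
        refine hh i fun w hw => ?_
        have := hi hw
        rw [Finset.coe_insert] at this
        rcases this with rfl | h
        · exact absurd hw hvi
        · exact h
  have := Fintype.ofFinite V
  obtain ⟨h, hh⟩ := key Finset.univ
  exact ⟨h, fun i => hh i (by simp)⟩

/-! ### Cycles as periodic sequences of darts -/

section DartCycle

variable {V α : Type*} {G : SimpleGraph V}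

/-- A cycle of length `n` in the graph obtained from `G` by identifying vertices according to `c`,
as an `n`-periodic sequence of darts of `G`. -/
structure DartCycle (c : V → α) (n : ℕ) (d : ℕ → G.Dart) : Prop where
  pos : 0 < n
  periodic : ∀ i j, i ≡ j [MOD n] → d i = d j
  link : ∀ i, c (d i).snd = c (d (i + 1)).fst
  fst_inj : ∀ i j, c (d i).fst = c (d j).fst → i ≡ j [MOD n]
  edge_inj : ∀ i j, (d i).edge = (d j).edge → i ≡ j [MOD n]

/-- The edges used by a sequence of darts. -/
def dartEdges (d : ℕ → G.Dart) : Set (Sym2 V) := Set.range fun i => (d i).edge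

namespace DartCycle

variable {c : V → α} {n : ℕ} {d : ℕ → G.Dart}

lemma shift (h : DartCycle c n d) (k : ℕ) : DartCycle c n fun i => d (i + k) where
  pos := h.pos
  periodic i j hij := h.periodic _ _ (hij.add_right k)
  link i := by rw [h.link (i + k), show i + k + 1 = i + 1 + k by omega]
  fst_inj i j hij := Nat.ModEq.add_right_cancel' k (h.fst_inj _ _ hij)
  edge_inj i j hij := Nat.ModEq.add_right_cancel' k (h.edge_inj _ _ hij)

lemma mod_eq (h : DartCycle c n d) (i : ℕ) : d (i % n) = d i :=
  h.periodic _ _ (Nat.mod_modEq i n)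

lemma exists_lt (h : DartCycle c n d) (i : ℕ) : ∃ j < n, d j = d i :=
  ⟨i % n, Nat.mod_lt _ h.pos, h.mod_eq i⟩

lemma apply_period (h : DartCycle c n d) : d n = d 0 :=
  h.periodic _ _ (by simp [Nat.ModEq])

lemma dartEdges_eq_image (h : DartCycle c n d) :
    dartEdges d = (fun i => (d i).edge) '' Set.Iio n := by
  ext e
  constructor
  · rintro ⟨i, rfl⟩
    obtain ⟨j, hj, hji⟩ := h.exists_lt i
    exact ⟨j, hj, by simp only [hji]⟩
  · rintro ⟨i, -, rfl⟩
    exact ⟨i, rfl⟩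

lemma eq_of_modEq_of_lt {i j : ℕ} (hi : i < n) (hj : j < n) (hij : i ≡ j [MOD n]) : i = j := by
  rwa [Nat.ModEq, Nat.mod_eq_of_lt hi, Nat.mod_eq_of_lt hj] at hij

lemma ncard_dartEdges (h : DartCycle c n d) : (dartEdges d).ncard = n := by
  rw [h.dartEdges_eq_image, Set.InjOn.ncard_image]
  · simp [← Finset.coe_Iio, Set.ncard_coe_finset]
  · intro i hi j hj hij
    exact eq_of_modEq_of_lt hi hj (h.edge_inj i j hij)

lemma dartEdges_shift (h : DartCycle c n d) (k : ℕ) :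
    dartEdges (fun i => d (i + k)) = dartEdges d := by
  ext e
  constructor
  · rintro ⟨i, rfl⟩
    exact ⟨i + k, rfl⟩
  · rintro ⟨i, rfl⟩
    refine ⟨i + (n * k - k), ?_⟩
    have : k ≤ n * k := Nat.le_mul_of_pos_left k h.pos
    simp only
    rw [h.periodic (i + (n * k - k) + k) i]
    rw [show i + (n * k - k) + k = i + n * k by omega]
    simp [Nat.ModEq]

lemma le_card_of_forall_mem (h : DartCycle c n d) (s : Finset α)
    (hs : ∀ i, c (d i).fst ∈ s) : n ≤ s.card := by
  have := Finset.card_le_card_of_injOn (s := Finset.range n) (t := s) (fun i => c (d i).fst)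
    (fun i _ => hs i) fun i hi j hj hij => by
      exact eq_of_modEq_of_lt (by simpa using hi) (by simpa using hj) (h.fst_inj i j hij)
  simpa using this

end DartCycle

/-- There is a choice `h` of potentials for which a cycle in the identified graph has value `1` in
the labelling `h (q u)⁻¹ γ ^ ψ h (q v)` only if it is closed already after identification
according to `q`. -/
lemma exists_generic_potential {Γ : Type*} [Group Γ] [Infinite Γ] [Finite V] (c : V → α)
    (q : V → V) (hq : ∀ a b, q a = q b → c a = c b) (γ : Γ) (ψ : G.Dart → ℤ) :
    ∃ h : V → Γ, ∀ n (d : ℕ → G.Dart), DartCycle c n d →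
      (rangeProd (fun i => (h (q (d i).fst))⁻¹ * γ ^ ψ (d i) * h (q (d i).snd)) n = 1 ↔
        (∀ i, q (d i).snd = q (d (i + 1)).fst) ∧ γ ^ ∑ i ∈ Finset.range n, ψ (d i) = 1) := by
  classical
  have : Finite G.Dart := Finite.of_injective _ (SimpleGraph.Dart.toProd_injective (G := G))
  have := Fintype.ofFinite G.Dart
  set N := Fintype.card G.Dart
  -- A cycle has distinct edges, so its length is at most `N` and this finite type encodes all
  -- cycles. Only the entries before the length matter.
  let D : (Fin (N + 1) × (Fin (N + 1) → G.Dart)) → ℕ → G.Dart :=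
    fun x i => x.2 (Fin.ofNat (N + 1) (i % x.1))
  let ι := {x : Fin (N + 1) × (Fin (N + 1) → G.Dart) // DartCycle c x.1 (D x) ∧
    ∃ i, q (D x i).snd ≠ q (D x (i + 1)).fst}
  -- The gain conjugated by `h (q (d 0).fst)`: the potentials are grouped by junctions and cancel
  -- wherever the cycle closes up under `q`.
  let word : (ℕ → G.Dart) → ℕ → (V → Γ) → Γ := fun d n h =>
    rangeProd (fun i => γ ^ ψ (d i) * (h (q (d i).snd) * (h (q (d (i + 1)).fst))⁻¹)) n
  let supp : (ℕ → G.Dart) → Set V := fun d =>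
    {v | ∃ i, q (d i).snd ≠ q (d (i + 1)).fst ∧ (v = q (d i).snd ∨ v = q (d (i + 1)).fst)}
  have hgen : ∃ h : V → Γ, ∀ x : ι, word (D x.1) x.1.1 h ≠ 1 := by
    refine exists_generic (fun x : ι => supp (D x.1)) (fun x : ι => word (D x.1) x.1.1) ?_ ?_ ?_
    · rintro ⟨x, hx, i, hi⟩
      exact ⟨_, i, hi, Or.inl rfl⟩
    · rintro ⟨x, hx, _⟩ v hv h y
      refine rangeProd_congr fun i _ => ?_
      by_cases hi : q (D x i).snd = q (D x (i + 1)).fst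
      · simp [hi]
      · have h1 : q (D x i).snd ≠ v := fun he => hv ⟨i, hi, Or.inl he.symm⟩
        have h2 : q (D x (i + 1)).fst ≠ v := fun he => hv ⟨i, hi, Or.inr he.symm⟩
        rw [Function.update_of_ne h1, Function.update_of_ne h2]
    · rintro ⟨x, hx, _⟩ v ⟨i, hi, hv⟩ h y z hyz
      obtain ⟨j, hj, hji⟩ : ∃ j < (x.1 : ℕ), j ≡ i [MOD x.1] :=
        ⟨i % x.1, Nat.mod_lt _ hx.pos, Nat.mod_modEq _ _⟩
      rw [← hx.periodic _ _ hji, ← hx.periodic _ _ (hji.add_right 1)] at hi hv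
      have hrep : ∀ k, (v = q (D x k).snd ∨ v = q (D x (k + 1)).fst) →
          ∃ a, q a = v ∧ c a = c (D x (k + 1)).fst := by
        rintro k (hk | hk)
        · exact ⟨_, hk.symm, hx.link k⟩
        · exact ⟨_, hk.symm, rfl⟩
      -- `q` refines `c` and the cycle visits each class of `c` once, so the variable `v` occurs at
      -- the junction `j` only.
      have hother : ∀ k < (x.1 : ℕ), k ≠ j →
          q (D x k).snd ≠ v ∧ q (D x (k + 1)).fst ≠ v := by
        intro k hk hkj
        by_contra hcon
        obtain ⟨a, hav, ha⟩ := hrep k (by grind)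
        obtain ⟨b, hbv, hb⟩ := hrep j hv
        have hab := hq a b (hav.trans hbv.symm)
        rw [ha, hb] at hab
        exact hkj (DartCycle.eq_of_modEq_of_lt hk hj
          (Nat.ModEq.add_right_cancel' 1 (hx.fst_inj _ _ hab)))
      have := eq_of_rangeProd_eq hj (fun k hk hkj => by
        obtain ⟨h1, h2⟩ := hother k hk hkj
        simp only [Function.update_of_ne h1, Function.update_of_ne h2]) hyz
      have := mul_left_cancel this
      rcases hv with hv | hv
      · rw [← hv] at hi this
        rw [Function.update_of_ne hi.symm, Function.update_of_ne hi.symm] at this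
        simpa using this
      · rw [← hv] at hi this
        rw [Function.update_of_ne hi, Function.update_of_ne hi] at this
        simpa using this
  obtain ⟨h, hh⟩ := hgen
  refine ⟨h, fun n d hd => ?_⟩
  have hiff : rangeProd (fun i => (h (q (d i).fst))⁻¹ * γ ^ ψ (d i) * h (q (d i).snd)) n = 1 ↔
      word d n h = 1 := by
    rw [rangeProd_regroup (fun i => h (q (d i).fst)) (fun i => h (q (d i).snd)), hd.apply_period]
    constructor
    · intro h1
      have := congrArg (fun z => h (q (d 0).fst) * z * (h (q (d 0).fst))⁻¹) h1
      simpa [mul_assoc] using this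
    · intro h1
      simp only [word] at h1
      rw [h1]
      simp
  have hclosed : (∀ i, q (d i).snd = q (d (i + 1)).fst) →
      word d n h = γ ^ ∑ i ∈ Finset.range n, ψ (d i) := by
    intro hc
    rw [← rangeProd_zpow]
    exact rangeProd_congr fun i _ => by simp [hc i]
  rw [hiff]
  constructor
  · intro h1
    by_cases hc : ∀ i, q (d i).snd = q (d (i + 1)).fst
    · exact ⟨hc, (hclosed hc) ▸ h1⟩
    · exfalso
      push Not at hc
      have hn : n < N + 1 := by
        have := Fintype.card_le_of_injective (fun i : Fin n => d i) fun i j hij =>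
          Fin.ext (DartCycle.eq_of_modEq_of_lt i.2 j.2 (hd.edge_inj _ _ (by
            simp only at hij; rw [hij])))
        simp only [Fintype.card_fin] at this
        omega
      let x : Fin (N + 1) × (Fin (N + 1) → G.Dart) := (⟨n, hn⟩, fun i => d i)
      have hx : D x = d := by
        funext i
        simp only [D, x]
        rw [← hd.mod_eq i]
        congr 1
        simp only [Fin.ofNat]
        exact Nat.mod_eq_of_lt ((Nat.mod_lt i hd.pos).trans hn)
      have := hh ⟨x, by rw [hx]; exact ⟨hd, hc⟩⟩
      simp only [hx] at this
      exact this h1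
  · rintro ⟨hc, h1⟩
    rw [hclosed hc, h1]

end DartCycle

/-! ### Cycles of the identified graph -/

section Models

variable {V α : Type*} {G : SimpleGraph V}

/-- `K` is obtained from `G` by deleting the edges in `X` and identifying vertices according
to `c`. -/
def IsIdentification (K : Graph α (Sym2 V)) (G : SimpleGraph V) (c : V → α) (X : Set (Sym2 V)) :
    Prop :=
  ∀ f a b, K.IsLink f a b ↔ f ∉ X ∧ ∃ d : G.Dart, d.edge = f ∧ c d.fst = a ∧ c d.snd = b

/-- A walk in the identified graph lifts to a sequence of darts whose labels multiply to its
gain. -/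
lemma Graph.Walk.exists_lift {K : Graph α (Sym2 V)} {c : V → α} {Γ : Type*} [Group Γ]
    (φ : K.GroupLabelling Γ) (ℓ : G.Dart → Γ)
    (hstep : ∀ e u v (h : K.IsLink e u v), ∃ d : G.Dart, d.edge = e ∧ c d.fst = u ∧ c d.snd = v ∧
      ((u = φ.tail ⟨e, h.edge_mem⟩ → ℓ d = φ.label ⟨e, h.edge_mem⟩) ∧
        (u ≠ φ.tail ⟨e, h.edge_mem⟩ → ℓ d = (φ.label ⟨e, h.edge_mem⟩)⁻¹)))
    {u v : α} (p : K.Walk u v) :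
    ∃ L : List G.Dart, L.map SimpleGraph.Dart.edge = p.edges ∧
      L.map (fun d => c d.fst) ++ [v] = p.support ∧ u :: L.map (fun d => c d.snd) = p.support ∧
      (L.map ℓ).prod = p.gain φ := by
  induction p with
  | nil hu => exact ⟨[], by simp [Graph.Walk.edges, Graph.Walk.support, Graph.Walk.gain]⟩
  | cons e h p ih =>
    obtain ⟨L, h1, h2, h3, h4⟩ := ih
    obtain ⟨d, hd, hu, hv, ht, hf⟩ := hstep _ _ _ h
    refine ⟨d :: L, ?_, ?_, ?_, ?_⟩
    · simp [Graph.Walk.edges, h1, hd]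
    · simp [Graph.Walk.support, ← h2, hu]
    · simp [Graph.Walk.support, ← h3, hv]
    · simp only [List.map_cons, List.prod_cons, h4, Graph.Walk.gain]
      split_ifs with hc
      · rw [ht hc]
      · rw [hf hc]

lemma dartCycle_of_list {c : V → α} {a : α} {L : List G.Dart} (hL : 0 < L.length)
    (he : (L.map SimpleGraph.Dart.edge).Nodup) (hn : (L.map fun d => c d.snd).Nodup)
    (hc : L.map (fun d => c d.fst) ++ [a] = a :: L.map fun d => c d.snd) :
    DartCycle c L.length fun i => L[i % L.length]'(Nat.mod_lt _ hL) := by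
  -- The initial classes are the terminal classes rotated by one place.
  have hn' : (L.map fun d => c d.fst).Nodup := by
    have hperm : (a :: L.map fun d => c d.fst).Perm (a :: L.map fun d => c d.snd) := by
      rw [← hc]; exact (List.perm_append_singleton _ _).symm
    exact (List.perm_cons a).1 hperm |>.nodup_iff.2 hn
  have hget : ∀ i (hi : i < L.length), (L.map (fun d => c d.fst) ++ [a])[i + 1]'(by simpa using hi)
      = c (L[i]).snd := by
    intro i hi
    simp only [hc, List.getElem_cons_succ, List.getElem_map]
  refine ⟨hL, fun i j hij => ?_, fun i => ?_, fun i j hij => ?_, fun i j hij => ?_⟩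
  · have : i % L.length = j % L.length := hij
    simp only [this]
  · have hi := Nat.mod_lt i hL
    rw [← hget _ hi]
    rcases Nat.lt_or_ge (i % L.length + 1) L.length with h | h
    · have : (i + 1) % L.length = i % L.length + 1 := by
        rw [Nat.add_mod, Nat.mod_eq_of_lt (a := 1) (by omega), Nat.mod_eq_of_lt h]
      rw [List.getElem_append_left (by simpa using h)]
      simp [this]
    · have h' : i % L.length + 1 = L.length := by omega
      have h0 : (i + 1) % L.length = 0 := by
        rw [← Nat.mod_add_mod, h', Nat.mod_self]
      rw [List.getElem_append_right (by simpa using h)]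
      have h2 : (L.map (fun d => c d.fst) ++ [a])[0]'(by simp) = a := by simp only [hc]; rfl
      rw [List.getElem_append_left (by simpa using hL)] at h2
      simp only [List.getElem_map] at h2
      simp [h0, h2]
  · have := hn'.getElem_inj_iff (i := i % L.length) (j := j % L.length)
      (hi := by simpa using Nat.mod_lt i hL) (hj := by simpa using Nat.mod_lt j hL)
    exact this.1 (by simpa using hij)
  · have := he.getElem_inj_iff (i := i % L.length) (j := j % L.length)
      (hi := by simpa using Nat.mod_lt i hL) (hj := by simpa using Nat.mod_lt j hL)
    exact this.1 (by simpa using hij)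

/-- Turns the gain into an ordered product over darts: `hstep` supplies, above each traversed link,
a dart whose label is the factor that `gain` contributes. -/
lemma Graph.Walk.IsCycle.exists_dartCycle {K : Graph α (Sym2 V)} {c : V → α} {Γ : Type*} [Group Γ]
    {φ : K.GroupLabelling Γ} {ℓ : G.Dart → Γ}
    (hstep : ∀ e u v (h : K.IsLink e u v), ∃ d : G.Dart, d.edge = e ∧ c d.fst = u ∧ c d.snd = v ∧
      ((u = φ.tail ⟨e, h.edge_mem⟩ → ℓ d = φ.label ⟨e, h.edge_mem⟩) ∧
        (u ≠ φ.tail ⟨e, h.edge_mem⟩ → ℓ d = (φ.label ⟨e, h.edge_mem⟩)⁻¹)))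
    {u : α} {p : K.Walk u u} (hp : p.IsCycle) :
    ∃ n d, DartCycle (G := G) c n d ∧ dartEdges d = p.edgeSet ∧
      rangeProd (fun i => ℓ (d i)) n = p.gain φ := by
  obtain ⟨L, h1, h2, h3, h4⟩ := p.exists_lift φ ℓ hstep
  have hL : 0 < L.length := by
    rcases L with _ | ⟨d, L⟩
    · exact absurd h1.symm hp.ne_nil
    · simp
  have hcyc := dartCycle_of_list hL (h1 ▸ hp.edges_nodup)
    (by have := hp.support_tail_nodup; rwa [← h3] at this) (h2.trans h3.symm)
  refine ⟨_, _, hcyc, ?_, ?_⟩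
  · rw [hcyc.dartEdges_eq_image]
    ext e
    constructor
    · rintro ⟨i, hi, rfl⟩
      exact (h1 ▸ List.mem_map_of_mem (List.getElem_mem _) : _ ∈ p.edges)
    · intro he
      have he' : e ∈ p.edges := he
      rw [← h1, List.mem_map] at he'
      obtain ⟨d, hd, rfl⟩ := he'
      obtain ⟨i, hi, rfl⟩ := List.mem_iff_getElem.1 hd
      exact ⟨i, hi, by simp [Nat.mod_eq_of_lt hi]⟩
  · rw [← h4, rangeProd]
    congr 1
    refine List.ext_getElem (by simp) fun i hi hi' => ?_
    simp at hi
    simp [Nat.mod_eq_of_lt hi]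

/-- A cycle given by darts is a cycle of the identified graph. -/
lemma DartCycle.isCycleSet {K : Graph α (Sym2 V)} {c : V → α} {X : Set (Sym2 V)}
    (hK : IsIdentification K G c X) {n : ℕ} {d : ℕ → G.Dart} (hd : DartCycle c n d)
    (hX : ∀ i, (d i).edge ∉ X) : K.IsCycleSet (dartEdges d) := by
  have hlink : ∀ i, K.IsLink (d i).edge (c (d i).fst) (c (d (i + 1)).fst) := fun i =>
    (hK _ _ _).2 ⟨hX i, d i, rfl, rfl, hd.link i⟩
  have key : ∀ k i w, w = c (d (i + k)).fst → ∃ p : K.Walk (c (d i).fst) w,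
      p.edges = (List.range' i k).map (fun j => (d j).edge) ∧
      p.support = (List.range' i (k + 1)).map fun j => c (d j).fst := by
    intro k
    induction k with
    | zero =>
      rintro i w rfl
      exact ⟨.nil (hlink i).left_mem, by simp [Graph.Walk.edges, Graph.Walk.support]⟩
    | succ k ih =>
      rintro i w hw
      obtain ⟨p, h1, h2⟩ := ih (i + 1) w (by rw [hw, show i + (k + 1) = i + 1 + k by omega])
      refine ⟨.cons _ (hlink i) p, ?_, ?_⟩
      · simp [Graph.Walk.edges, h1, List.range'_succ]
      · simp [Graph.Walk.support, h2, List.range'_succ]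
  obtain ⟨p, h1, h2⟩ := key n 0 (c (d 0).fst) (by rw [zero_add, hd.apply_period])
  refine ⟨_, p, ⟨?_, ?_, ?_⟩, ?_⟩
  · rw [h1]
    simpa using hd.pos.ne'
  · rw [h1]
    refine List.Nodup.map_on (fun i hi j hj hij => ?_) (List.nodup_range')
    simp only [List.mem_range'_1] at hi hj
    exact DartCycle.eq_of_modEq_of_lt (by omega) (by omega) (hd.edge_inj _ _ hij)
  · rw [h2, List.range'_succ, List.map_cons, List.tail_cons]
    refine List.Nodup.map_on (fun i hi j hj hij => ?_) (List.nodup_range')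
    simp only [List.mem_range'_1] at hi hj
    have := hd.fst_inj _ _ hij
    have : i - 1 ≡ j - 1 [MOD n] := Nat.ModEq.add_right_cancel' 1
      (by rwa [Nat.sub_add_cancel (by omega), Nat.sub_add_cancel (by omega)])
    have := DartCycle.eq_of_modEq_of_lt (by omega) (by omega) this
    omega
  · rw [hd.dartEdges_eq_image]
    ext e
    simp only [Graph.Walk.edgeSet, h1]
    simp

/-- A criterion for labellability in terms of a labelling of the darts. -/
lemma IsIdentification.labellable {K : Graph α (Sym2 V)} {c : V → α} {X : Set (Sym2 V)}
    (hK : IsIdentification K G c X) {Γ : Type*} [Group Γ] {ℓ : G.Dart → Γ}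
    (hℓ : ∀ d, ℓ d.symm = (ℓ d)⁻¹) {𝓑 : Set (Set (Sym2 V))} (h𝓑 : ∀ C ∈ 𝓑, K.IsCycleSet C)
    (h : ∀ n d, DartCycle c n d → (∀ i, (d i).edge ∉ X) →
      (rangeProd (fun i => ℓ (d i)) n = 1 ↔ dartEdges d ∈ 𝓑)) :
    K.Labellable 𝓑 Γ := by
  have hD : ∀ e : E(K), ∃ d : G.Dart, d.edge = e ∧ K.IsLink e (c d.fst) (c d.snd) := by
    rintro ⟨e, he⟩
    obtain ⟨x, y, hxy⟩ := K.exists_isLink_of_mem_edgeSet he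
    obtain ⟨-, d, hd, rfl, rfl⟩ := (hK _ _ _).1 hxy
    exact ⟨d, hd, hxy⟩
  choose D hDe hDl using hD
  let φ : K.GroupLabelling Γ :=
    ⟨fun e => c (D e).fst, fun e => ⟨_, hDl e⟩, fun e => ℓ (D e)⟩
  have hstep : ∀ e u v (h : K.IsLink e u v),
      ∃ d : G.Dart, d.edge = e ∧ c d.fst = u ∧ c d.snd = v ∧
      ((u = φ.tail ⟨e, h.edge_mem⟩ → ℓ d = φ.label ⟨e, h.edge_mem⟩) ∧
        (u ≠ φ.tail ⟨e, h.edge_mem⟩ → ℓ d = (φ.label ⟨e, h.edge_mem⟩)⁻¹)) := by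
    intro e u v h
    have hl := hDl ⟨e, h.edge_mem⟩
    have he := hDe ⟨e, h.edge_mem⟩
    simp only [φ]
    rcases hl.eq_and_eq_or_eq_and_eq h with ⟨h1, h2⟩ | ⟨h1, h2⟩
    · exact ⟨_, he, h1, h2, fun _ => rfl, fun hne => absurd h1.symm hne⟩
    -- Here the edge is a loop of `K`. Loops are read forward by `gain`, so the chosen dart is kept
    -- rather than its reverse.
    · by_cases hu : u = c (D ⟨e, h.edge_mem⟩).fst
      · refine ⟨_, he, hu.symm, ?_, fun _ => rfl, fun hne => absurd hu hne⟩
        rw [h2, ← h1, ← hu]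
      · exact ⟨(D ⟨e, h.edge_mem⟩).symm, by simpa using he, h2, h1,
          fun he => absurd he hu, fun _ => hℓ _⟩
  have hX : ∀ {u : α} {p : K.Walk u u}, ∀ e ∈ p.edgeSet, e ∉ X := by
    intro u p e he
    have : ∀ {u v : α} (p : K.Walk u v), ∀ e ∈ p.edges, e ∉ X := by
      intro u v p
      induction p with
      | nil => simp [Graph.Walk.edges]
      | cons e h p ih =>
        intro f hf
        simp only [Graph.Walk.edges, List.mem_cons] at hf
        rcases hf with rfl | hf
        · exact ((hK _ _ _).1 h).1
        · exact ih f hf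
    exact this p e he
  refine ⟨φ, ?_⟩
  ext C
  constructor
  · rintro ⟨u, p, hp, rfl, hg⟩
    obtain ⟨n, d, hd, hde, hdp⟩ := hp.exists_dartCycle hstep
    rw [← hde]
    refine (h n d hd fun i => ?_).1 (hdp.trans hg)
    exact hX (p := p) _ (hde ▸ ⟨i, rfl⟩)
  · intro hC
    obtain ⟨u, p, hp, rfl⟩ := h𝓑 C hC
    obtain ⟨n, d, hd, hde, hdp⟩ := hp.exists_dartCycle hstep
    refine ⟨u, p, hp, rfl, hdp.symm.trans ((h n d hd fun i => ?_).2 (hde ▸ hC))⟩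
    exact hX (p := p) _ (hde ▸ ⟨i, rfl⟩)

/-- A closed sequence of darts of `G` without repeated vertices is a
cycle of `G`. -/
lemma DartCycle.exists_isCycle {n : ℕ} {d : ℕ → G.Dart} (hd : DartCycle id n d) :
    ∃ w : G.Walk (d 0).fst (d 0).fst, w.IsCycle ∧ w.length = n ∧
      {e | e ∈ w.edges} = dartEdges d := by
  have key : ∀ k i w, w = (d (i + k)).fst → ∃ p : G.Walk (d i).fst w,
      p.edges = (List.range' i k).map (fun j => (d j).edge) ∧
      p.support = (List.range' i (k + 1)).map fun j => (d j).fst := by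
    intro k
    induction k with
    | zero =>
      rintro i w rfl
      exact ⟨.nil, by simp⟩
    | succ k ih =>
      rintro i w hw
      obtain ⟨p, h1, h2⟩ := ih (i + 1) w (by rw [hw, show i + (k + 1) = i + 1 + k by omega])
      have hl : (d i).snd = (d (i + 1)).fst := hd.link i
      refine ⟨.cons (hl ▸ (d i).adj) p, ?_, ?_⟩
      · simp [h1, List.range'_succ, ← hl, SimpleGraph.Dart.edge]
      · simp [h2, List.range'_succ]
  obtain ⟨p, h1, h2⟩ := key n 0 (d 0).fst (by rw [zero_add, hd.apply_period])
  have hlen : p.length = n := by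
    rw [← SimpleGraph.Walk.length_edges, h1]; simp
  refine ⟨p, SimpleGraph.Walk.isCycle_def p |>.2 ⟨⟨?_⟩, ?_, ?_⟩, hlen, ?_⟩
  · rw [h1]
    refine List.Nodup.map_on (fun i hi j hj hij => ?_) (List.nodup_range')
    simp only [List.mem_range'_1] at hi hj
    exact DartCycle.eq_of_modEq_of_lt (by omega) (by omega) (hd.edge_inj _ _ hij)
  · rintro rfl
    exact hd.pos.ne' (by simpa using hlen.symm)
  · rw [h2, List.range'_succ, List.map_cons, List.tail_cons]
    refine List.Nodup.map_on (fun i hi j hj hij => ?_) (List.nodup_range')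
    simp only [List.mem_range'_1] at hi hj
    have := hd.fst_inj _ _ hij
    have : i - 1 ≡ j - 1 [MOD n] := Nat.ModEq.add_right_cancel' 1
      (by rwa [Nat.sub_add_cancel (by omega), Nat.sub_add_cancel (by omega)])
    have := DartCycle.eq_of_modEq_of_lt (by omega) (by omega) this
    omega
  · rw [hd.dartEdges_eq_image]
    ext e
    simp only [h1]
    simp

lemma isIdentification_ofSimpleGraph_map (c : V → α) :
    IsIdentification ((Graph.ofSimpleGraph G).map c) G c ∅ := by
  intro f a b
  simp only [Graph.map_isLink, Set.mem_empty_iff_false, not_false_eq_true, true_and,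
    Relation.Map, Graph.ofSimpleGraph]
  constructor
  · rintro ⟨u, v, ⟨rfl, h⟩, rfl, rfl⟩
    exact ⟨⟨(u, v), h⟩, rfl, rfl, rfl⟩
  · rintro ⟨d, rfl, rfl, rfl⟩
    exact ⟨d.fst, d.snd, ⟨rfl, d.edge_mem⟩, rfl, rfl⟩

lemma IsIdentification.deleteEdges {K : Graph α (Sym2 V)} {c : V → α}
    (hK : IsIdentification K G c ∅) (X : Set (Sym2 V)) :
    IsIdentification (K.deleteEdges X) G c X := by
  intro f a b
  rw [Graph.deleteEdges_isLink, hK]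
  simp only [Set.mem_empty_iff_false, not_false_eq_true, true_and]
  tauto

lemma IsIdentification.map {α' : Type*} {K : Graph α (Sym2 V)} {c : V → α} {X : Set (Sym2 V)}
    (hK : IsIdentification K G c X) (m : α → α') :
    IsIdentification (K.map m) G (m ∘ c) X := by
  intro f a b
  simp only [Graph.map_isLink, Relation.Map, hK f]
  constructor
  · rintro ⟨u, v, ⟨h, d, rfl, rfl, rfl⟩, rfl, rfl⟩
    exact ⟨h, d, rfl, rfl, rfl⟩
  · rintro ⟨h, d, rfl, rfl, rfl⟩
    exact ⟨_, _, ⟨h, d, rfl, rfl, rfl⟩, rfl, rfl⟩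

end Models

/-! ### Faces of rotation systems -/

section Faces

variable {V : Type*} {G : SimpleGraph V}

lemma SimpleGraph.Connected.mem_of_dart_closed (hG : G.Connected) {S : Set V} {v : V} (hv : v ∈ S)
    (h : ∀ d : G.Dart, d.fst ∈ S → d.snd ∈ S) (w : V) : w ∈ S := by
  obtain ⟨p⟩ := hG.preconnected v w
  induction p with
  | nil => exact hv
  | cons hadj p ih => exact ih (h ⟨(_, _), hadj⟩ hv)

instance [Finite V] : Finite G.Dart :=
  Finite.of_injective _ (SimpleGraph.Dart.toProd_injective (G := G))

namespace RotationSystem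

variable (R : RotationSystem G)

@[simp] lemma facePerm_symm (d : G.Dart) : R.facePerm d.symm = R.next d := by
  simp [facePerm]

lemma facePerm_eq (d : G.Dart) : R.facePerm d = R.next d.symm := rfl

@[simp] lemma facePerm_fst (d : G.Dart) : (R.facePerm d).fst = d.snd := by
  rw [facePerm_eq, R.fst_next]; rfl

lemma face_eq_iff {d d' : G.Dart} : R.face d = R.face d' ↔ R.facePerm.SameCycle d d' :=
  Quotient.eq (r := Equiv.Perm.SameCycle.setoid R.facePerm)

@[simp] lemma face_facePerm (d : G.Dart) : R.face (R.facePerm d) = R.face d := by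
  rw [face_eq_iff]; exact Equiv.Perm.sameCycle_apply_left.2 (Equiv.Perm.SameCycle.refl _ _)

@[simp] lemma face_facePerm_pow (i : ℕ) (d : G.Dart) : R.face ((R.facePerm ^ i) d) = R.face d := by
  rw [face_eq_iff]; exact Equiv.Perm.sameCycle_pow_left.2 (Equiv.Perm.SameCycle.refl _ _)

lemma face_next (d : G.Dart) : R.face (R.next d) = R.face d.symm := by
  rw [← facePerm_symm, face_facePerm]

lemma exists_face_eq (f : R.Face) : ∃ d, R.face d = f := Quotient.exists_rep f

lemma mem_boundary_iff {d : G.Dart} {f : R.Face} :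
    d.edge ∈ R.boundary f ↔ R.face d = f ∨ R.face d.symm = f := by
  constructor
  · rintro ⟨a, ha, hd⟩
    rcases (SimpleGraph.dart_edge_eq_iff _ _).1 hd with rfl | rfl
    · exact Or.inl ha
    · exact Or.inr ha
  · rintro (h | h)
    · exact ⟨d, h, rfl⟩
    · exact ⟨d.symm, h, by simp⟩

instance [Finite V] : Finite R.Face := inferInstanceAs (Finite (Quotient _))

/-- The induction principle along the rotation at a vertex. -/
lemma rotation_induction [Finite V] {p : G.Dart → Prop} {d : G.Dart} (hd : p d)
    (h : ∀ x, x.fst = d.fst → p x → p (R.next x)) {x : G.Dart} (hx : x.fst = d.fst) : p x := by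
  obtain ⟨i, rfl⟩ := (R.sameCycle d x hx.symm).exists_nat_pow_eq
  have hfst : ∀ i, ((R.next ^ i) d).fst = d.fst := by
    intro i
    induction i with
    | zero => rfl
    | succ i ih => rw [pow_succ', Equiv.Perm.mul_apply, R.fst_next, ih]
  clear hx
  induction i with
  | zero => exact hd
  | succ i ih => rw [pow_succ', Equiv.Perm.mul_apply]; exact h _ (hfst i) ih

/-- The faces of a connected graph are connected through its edges. -/
lemma face_mem_of_closed [Finite V] (hG : G.Connected) {X : Set R.Face} {f : R.Face} (hf : f ∈ X)
    (h : ∀ d, R.face d ∈ X → R.face d.symm ∈ X) (f' : R.Face) : f' ∈ X := by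
  obtain ⟨d, rfl⟩ := R.exists_face_eq f
  obtain ⟨d', rfl⟩ := R.exists_face_eq f'
  have hat : ∀ d x : G.Dart, R.face d ∈ X → x.fst = d.fst → R.face x ∈ X := fun d x hd hx =>
    R.rotation_induction (p := fun x => R.face x ∈ X) hd
      (fun y _ hy => by rw [R.face_next]; exact h y hy) hx
  refine hG.mem_of_dart_closed (S := {v | ∀ x : G.Dart, x.fst = v → R.face x ∈ X}) (v := d.fst)
    (fun x hx => hat d x hf hx) (fun y hy x hx => hat y.symm x (h y (hy y rfl)) hx) d'.fst d' rfl

open Classical in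
/-- The sum of a function over the darts of a face. -/
noncomputable def faceSum [Fintype G.Dart] (ψ : G.Dart → ℤ) (f : R.Face) : ℤ :=
  ∑ d with R.face d = f, ψ d

open Classical in
/-- A flow in the dual graph from one face to another. -/
lemma exists_flow [Finite V] [Fintype G.Dart] (hG : G.Connected) (f₁ f₂ : R.Face) :
    ∃ ψ : G.Dart → ℤ, (∀ d, ψ d.symm = -ψ d) ∧
      ∀ f, R.faceSum ψ f = (if f = f₁ then 1 else 0) - if f = f₂ then 1 else 0 := by
  refine R.face_mem_of_closed hG (X := {f₂ | ∃ ψ : G.Dart → ℤ, (∀ d, ψ d.symm = -ψ d) ∧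
      ∀ f, R.faceSum ψ f = (if f = f₁ then 1 else 0) - if f = f₂ then 1 else 0}) (f := f₁)
    ⟨fun _ => 0, by simp, by simp [faceSum]⟩ ?_ f₂
  rintro d ⟨ψ, hψ, hs⟩
  -- One unit across the edge of `d` moves the sink from `R.face d` to `R.face d.symm`.
  refine ⟨fun x => ψ x + ((if x = d then 1 else 0) - if x = d.symm then 1 else 0), ?_, ?_⟩
  · intro x
    have h1 : x.symm = d ↔ x = d.symm := ⟨fun h => by rw [← h]; simp, fun h => by rw [h]; simp⟩
    have h2 : x.symm = d.symm ↔ x = d := SimpleGraph.Dart.symm_involutive.injective.eq_iff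
    simp only [hψ, h1, h2]
    ring
  · intro f
    have := hs f
    simp only [faceSum] at this ⊢
    rw [Finset.sum_add_distrib, this, Finset.sum_sub_distrib]
    simp only [Finset.sum_ite_eq', Finset.mem_filter, Finset.mem_univ, true_and,
      eq_comm (a := f)]
    ring

end RotationSystem
end Faces

/-! ### Colourings in which every colour appears once on every face -/

section Rainbow

variable {V α : Type*} {G : SimpleGraph V}

lemma SimpleGraph.Dart.mem_edge_iff {d : G.Dart} {v : V} : v ∈ d.edge ↔ v = d.fst ∨ v = d.snd :=
  Sym2.mem_iff

/-- The graph is connected, has a vertex of degree at least three, and every colour appears exactly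
once on every face. -/
structure RotationSystem.IsRainbow (R : RotationSystem G) {t : ℕ} (col : V → Fin t) : Prop where
  connected : G.Connected
  three_le_degree : ∃ a b c : G.Dart, b.fst = a.fst ∧ c.fst = a.fst ∧ a ≠ b ∧ a ≠ c ∧ b ≠ c
  existsUnique : ∀ (f : R.Face) (c : Fin t), ∃! d : G.Dart, R.face d = f ∧ col d.fst = c

namespace RotationSystem.IsRainbow

variable {R : RotationSystem G} {t : ℕ} {col : V → Fin t}

lemma eq_of_fst (h : R.IsRainbow col) {a b : G.Dart} (hf : R.face a = R.face b)
    (hc : col a.fst = col b.fst) : a = b :=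
  (h.existsUnique (R.face b) (col b.fst)).unique ⟨hf, hc⟩ ⟨rfl, rfl⟩

/-- This lifts adjacency from the identified graph to `G`: the successor of `a` and `b` start in the
same colour on one face. -/
lemma facePerm_eq_of_link (h : R.IsRainbow col) {a b : G.Dart} (hf : R.face a = R.face b)
    (hc : col a.snd = col b.fst) : R.facePerm a = b :=
  h.eq_of_fst (by simpa using hf) (by simpa using hc)

lemma eq_of_snd (h : R.IsRainbow col) {a b : G.Dart} (hf : R.face a = R.face b)
    (hc : col a.snd = col b.snd) : a = b :=
  R.facePerm.injective (h.eq_of_fst (by simpa using hf) (by simpa using hc))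

/-- Otherwise `d` would be its own successor on its face, hence a loop. This is why the identified
graph is loopless. -/
lemma col_fst_ne (h : R.IsRainbow col) (d : G.Dart) : col d.fst ≠ col d.snd := by
  intro hd
  have h1 : R.facePerm d = d := h.facePerm_eq_of_link rfl hd.symm
  have h2 := R.facePerm_fst d
  rw [h1] at h2
  exact d.adj.ne h2

/-- There is no nonempty closed set of vertices of degree at most two. -/
lemma false_of_degree_le_two (h : R.IsRainbow col) {S : Set V} {v : V} (hv : v ∈ S)
    (hS : ∀ d : G.Dart, d.fst ∈ S → d.snd ∈ S)
    (hdeg : ∀ v ∈ S, ∃ d d' : G.Dart, ∀ x : G.Dart, x.fst = v → x = d ∨ x = d') : False := by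
  obtain ⟨a, b, c, hb, hc, hab, hac, hbc⟩ := h.three_le_degree
  obtain ⟨d, d', hd⟩ := hdeg a.fst (h.connected.mem_of_dart_closed hv hS _)
  have h1 := hd a rfl
  have h2 := hd b hb
  have h3 := hd c hc
  grind

/-- The two sides of an edge are different faces. -/
lemma face_symm_ne [Finite V] (h : R.IsRainbow col) (d : G.Dart) : R.face d.symm ≠ R.face d := by
  intro hd
  -- With both directions on one face, both ends of the edge have degree one, and connectedness
  -- leaves a single edge.
  have h1 : R.next d = d := by
    rw [← R.facePerm_symm]
    exact h.facePerm_eq_of_link hd rfl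
  have h2 : R.next d.symm = d.symm := by
    rw [← R.facePerm_eq]
    exact h.facePerm_eq_of_link hd.symm rfl
  have key : ∀ d : G.Dart, R.next d = d → ∀ x : G.Dart, x.fst = d.fst → x = d := fun d hd x hx =>
    R.rotation_induction (p := fun x => x = d) rfl (by rintro _ - rfl; exact hd) hx
  refine h.false_of_degree_le_two (S := {d.fst, d.snd}) (v := d.fst) (by simp) ?_ ?_
  · rintro x (hx | hx)
    · rw [key d h1 x hx]; simp
    · rw [key d.symm h2 x hx]; simp
  · rintro v (rfl | rfl)
    · exact ⟨d, d, fun x hx => Or.inl (key d h1 x hx)⟩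
    · exact ⟨d.symm, d.symm, fun x hx => Or.inl (key d.symm h2 x hx)⟩

lemma eq_of_edge_eq [Finite V] (h : R.IsRainbow col) {a b : G.Dart} (hf : R.face a = R.face b)
    (he : a.edge = b.edge) : a = b := by
  rcases (SimpleGraph.dart_edge_eq_iff _ _).1 he with rfl | rfl
  · rfl
  · exact absurd hf (h.face_symm_ne b)

/-- Different faces have different boundaries. -/
lemma boundary_injective [Finite V] (h : R.IsRainbow col) :
    Function.Injective (R.boundary) := by
  intro f f' hff'
  by_contra hne
  have hop : ∀ d, R.face d = f → R.face d.symm = f' := by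
    intro d hd
    have : d.edge ∈ R.boundary f' := hff' ▸ ⟨d, hd, rfl⟩
    rcases R.mem_boundary_iff.1 this with h1 | h1
    · exact absurd (hd.symm.trans h1) hne
    · exact h1
  have hop' : ∀ d, R.face d = f' → R.face d.symm = f := by
    intro d hd
    have : d.edge ∈ R.boundary f := hff' ▸ ⟨d, hd, rfl⟩
    rcases R.mem_boundary_iff.1 this with h1 | h1
    · exact absurd (h1.symm.trans hd) hne
    · exact h1
  -- The rotation at a vertex of `f` alternates between `f` and `f'`. Each has only one dart leaving
  -- that vertex, so the degree is at most two.
  have hnext : ∀ d, R.face d = f → R.face (R.next d) = f' := fun d hd => by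
    rw [R.face_next, hop d hd]
  have hnext2 : ∀ d, R.face d = f → R.next (R.next d) = d := fun d hd =>
    h.eq_of_fst (by rw [R.face_next, hop' _ (hnext d hd), hd]) (by rw [R.fst_next, R.fst_next])
  have key : ∀ d, R.face d = f → ∀ x : G.Dart, x.fst = d.fst → x = d ∨ x = R.next d := by
    intro d hd x hx
    refine R.rotation_induction (p := fun x => x = d ∨ x = R.next d) (Or.inl rfl) ?_ hx
    rintro y - (rfl | rfl)
    · exact Or.inr rfl
    · exact Or.inl (hnext2 d hd)
  obtain ⟨d₀, hd₀⟩ := R.exists_face_eq f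
  refine h.false_of_degree_le_two (S := {v | ∃ d, R.face d = f ∧ d.fst = v})
    ⟨d₀, hd₀, rfl⟩ ?_ ?_
  · rintro x ⟨d, hd, hx⟩
    rcases key d hd x hx.symm with rfl | rfl
    · exact ⟨R.facePerm x, by simpa using hd, by simp⟩
    · exact ⟨(R.next d).symm, hop' _ (hnext d hd), rfl⟩
  · rintro v ⟨d, hd, rfl⟩
    exact ⟨d, R.next d, key d hd⟩

/-- The boundary walk of a face is a cycle of length `t` in the identified graph. -/
lemma dartCycle [Finite V] (h : R.IsRainbow col) (d : G.Dart) :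
    DartCycle col t fun i => (R.facePerm ^ i) d := by
  set σ := R.facePerm
  set n := Function.minimalPeriod σ d
  have hper : d ∈ Function.periodicPts σ := σ.injective.mem_periodicPts d
  have hn : 0 < n := Function.minimalPeriod_pos_of_mem_periodicPts hper
  have hiff : ∀ i j, (σ ^ i) d = (σ ^ j) d ↔ i ≡ j [MOD n] := by
    intro i j
    rw [← Equiv.Perm.iterate_eq_pow, ← Equiv.Perm.iterate_eq_pow,
      ← Function.iterate_mod_minimalPeriod_eq (n := i),
      ← Function.iterate_mod_minimalPeriod_eq (n := j),
      Function.iterate_eq_iterate_iff_of_lt_minimalPeriod (Nat.mod_lt _ hn) (Nat.mod_lt _ hn)]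
    rfl
  have hnt : n = t := by
    -- The orbit of `d` meets each of the `t` colours exactly once.
    have hbij : Function.Bijective fun i : Fin n => col ((σ ^ (i : ℕ)) d).fst := by
      constructor
      · intro i j hij
        have := h.eq_of_fst (by simp [σ]) hij
        exact Fin.ext (DartCycle.eq_of_modEq_of_lt i.2 j.2 ((hiff _ _).1 this))
      · intro c
        obtain ⟨x, ⟨hx, rfl⟩, -⟩ := h.existsUnique (R.face d) c
        obtain ⟨i, rfl⟩ := (R.face_eq_iff.1 hx.symm).exists_nat_pow_eq
        refine ⟨⟨i % n, Nat.mod_lt _ hn⟩, ?_⟩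
        simp only
        rw [(hiff (i % n) i).2 (Nat.mod_modEq _ _)]
    simpa using Nat.card_congr (Equiv.ofBijective _ hbij)
  rw [hnt] at hn hiff
  refine ⟨hn, fun i j => (hiff i j).2, fun i => ?_, fun i j hij => ?_, fun i j hij => ?_⟩
  · rw [pow_succ', Equiv.Perm.mul_apply, R.facePerm_fst]
  · exact (hiff i j).1 (h.eq_of_fst (by simp [σ]) hij)
  · exact (hiff i j).1 (h.eq_of_edge_eq (by simp [σ]) hij)

lemma dartEdges_face [Finite V] (d : G.Dart) :
    dartEdges (fun i => (R.facePerm ^ i) d) = R.boundary (R.face d) := by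
  ext e
  constructor
  · rintro ⟨i, rfl⟩
    exact ⟨_, by simp, rfl⟩
  · rintro ⟨x, hx, rfl⟩
    obtain ⟨i, rfl⟩ := (R.face_eq_iff.1 hx.symm).exists_nat_pow_eq
    exact ⟨i, rfl⟩

lemma ncard_boundary [Finite V] (h : R.IsRainbow col) (f : R.Face) :
    (R.boundary f).ncard = t := by
  obtain ⟨d, rfl⟩ := R.exists_face_eq f
  rw [← dartEdges_face, (h.dartCycle d).ncard_dartEdges]

lemma isCycleSet_boundary [Finite V] (h : R.IsRainbow col) {K : Graph (Fin t) (Sym2 V)}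
    {X : Set (Sym2 V)} (hK : IsIdentification K G col X) {f : R.Face}
    (hX : ∀ e ∈ R.boundary f, e ∉ X) : K.IsCycleSet (R.boundary f) := by
  obtain ⟨d, rfl⟩ := R.exists_face_eq f
  rw [← dartEdges_face] at hX ⊢
  exact (h.dartCycle d).isCycleSet hK fun i => hX _ ⟨i, rfl⟩

/-- Every edge on the boundary of a face is followed by exactly one other at each of its ends. -/
lemma existsUnique_boundary [Finite V] (h : R.IsRainbow col) {f : R.Face} {g : Sym2 V}
    (hg : g ∈ R.boundary f) {v : V} (hv : v ∈ g) :
    ∃! g', g' ∈ R.boundary f ∧ g' ≠ g ∧ v ∈ g' := by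
  -- the boundary edges at `v` are those of the dart `b` leaving `v` and of its predecessor `a`
  obtain ⟨a, b, ha, hb, hav, hbv⟩ : ∃ a b : G.Dart, R.face a = f ∧ R.face b = f ∧
      a.snd = v ∧ b.fst = v := by
    obtain ⟨d, hd, rfl⟩ := hg
    rw [SimpleGraph.Dart.mem_edge_iff] at hv
    rcases hv with rfl | rfl
    · exact ⟨R.facePerm.symm d, d, by rw [← R.face_facePerm]; simpa using hd, hd,
        by rw [← R.facePerm_fst]; simp, rfl⟩
    · exact ⟨d, R.facePerm d, hd, by simpa using hd, rfl, by simp⟩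
  have hall : ∀ g ∈ R.boundary f, v ∈ g → g = a.edge ∨ g = b.edge := by
    rintro _ ⟨d, hd, rfl⟩ hv
    rw [SimpleGraph.Dart.mem_edge_iff] at hv
    rcases hv with hv | hv
    · exact Or.inr (by rw [h.eq_of_fst (hd.trans hb.symm) (by rw [← hv, hbv])])
    · exact Or.inl (by rw [h.eq_of_snd (hd.trans ha.symm) (by rw [← hv, hav])])
  have hab : a.edge ≠ b.edge := by
    intro he
    have := h.eq_of_edge_eq (ha.trans hb.symm) he
    subst this
    exact a.adj.ne (hbv.trans hav.symm)
  have hva : v ∈ a.edge := by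
    rw [SimpleGraph.Dart.mem_edge_iff]; exact Or.inr hav.symm
  have hvb : v ∈ b.edge := by
    rw [SimpleGraph.Dart.mem_edge_iff]; exact Or.inl hbv.symm
  rcases hall g hg hv with rfl | rfl
  · refine ⟨b.edge, ⟨⟨b, hb, rfl⟩, hab.symm, hvb⟩, ?_⟩
    rintro g' ⟨h1, h2, h3⟩
    exact (hall g' h1 h3).resolve_left h2
  · refine ⟨a.edge, ⟨⟨a, ha, rfl⟩, hab, hva⟩, ?_⟩
    rintro g' ⟨h1, h2, h3⟩
    exact (hall g' h1 h3).resolve_right h2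

end RotationSystem.IsRainbow

/-! ### Orientation of cycles -/

/-- If the direction relative to `A` changed at a junction, two darts of `A` would start, or end, in
the same class. They would coincide, and the cycle would backtrack. -/
lemma DartCycle.orientation {c : V → α} {n : ℕ} {d : ℕ → G.Dart} (hd : DartCycle c n d)
    {A : Set G.Dart} (hfst : ∀ a ∈ A, ∀ b ∈ A, c a.fst = c b.fst → a = b)
    (hsnd : ∀ a ∈ A, ∀ b ∈ A, c a.snd = c b.snd → a = b)
    (hA : ∀ i, d i ∈ A ∨ (d i).symm ∈ A) :
    (∀ i, d i ∈ A) ∨ ∀ i, (d i).symm ∈ A := by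
  -- For `n = 1` the repeated edge is no contradiction; periodicity then makes `d i` its own
  -- reverse, which is one.
  have hne : ∀ i, d (i + 1) ≠ (d i).symm := by
    intro i hi
    have h1 := hd.edge_inj (i + 1) i (by rw [hi]; simp)
    have h2 := hd.periodic _ _ h1
    exact (d i).symm_ne (hi.symm.trans h2)
  rcases hA 0 with h0 | h0
  · left
    intro i
    induction i with
    | zero => exact h0
    | succ i ih =>
      refine (hA (i + 1)).resolve_right fun hc => hne i ?_
      have := hsnd _ hc _ ih (hd.link i).symm
      rw [← this]; simp
  · right
    intro i
    induction i with
    | zero => exact h0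
    | succ i ih =>
      exact (hA (i + 1)).resolve_left fun hc => hne i (hfst _ hc _ ih (hd.link i).symm)

/-- The sum of an antisymmetric function along a cycle that runs through the edges of a set `A` of
darts. -/
lemma DartCycle.sum_eq_or_eq_neg {c : V → α} {n : ℕ} {d : ℕ → G.Dart} (hd : DartCycle c n d)
    {A : Finset G.Dart} (hsymm : ∀ a ∈ A, a.symm ∉ A)
    (hor : (∀ i, d i ∈ A) ∨ ∀ i, (d i).symm ∈ A) (hcov : ∀ a ∈ A, a.edge ∈ dartEdges d)
    {ψ : G.Dart → ℤ} (hψ : ∀ d, ψ d.symm = -ψ d) :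
    ∑ i ∈ Finset.range n, ψ (d i) = ∑ a ∈ A, ψ a ∨
      ∑ i ∈ Finset.range n, ψ (d i) = -∑ a ∈ A, ψ a := by
  have hinj : ∀ i ∈ Finset.range n, ∀ j ∈ Finset.range n, (d i).edge = (d j).edge → i = j :=
    fun i hi j hj hij => DartCycle.eq_of_modEq_of_lt (by simpa using hi) (by simpa using hj)
      (hd.edge_inj i j hij)
  have hcov' : ∀ a ∈ A, ∃ i ∈ Finset.range n, a = d i ∨ a = (d i).symm := by
    intro a ha
    have := hcov a ha
    rw [hd.dartEdges_eq_image] at this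
    obtain ⟨i, hi, hia⟩ := this
    exact ⟨i, by simpa using hi, (SimpleGraph.dart_edge_eq_iff _ _).1 hia.symm⟩
  rcases hor with hor | hor
  · left
    refine Finset.sum_bij (fun i _ => d i) (fun i _ => hor i)
      (fun i hi j hj hij => hinj i hi j hj (by rw [hij])) ?_ (fun _ _ => rfl)
    intro a ha
    obtain ⟨i, hi, rfl | rfl⟩ := hcov' a ha
    · exact ⟨i, hi, rfl⟩
    · exact absurd ha (hsymm _ (hor i))
  · right
    rw [← Finset.sum_neg_distrib]
    refine Finset.sum_bij (fun i _ => (d i).symm) (fun i _ => hor i)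
      (fun i hi j hj hij => hinj i hi j hj ?_) ?_ (fun i _ => by rw [hψ]; simp)
    · rw [SimpleGraph.Dart.symm_involutive.injective hij]
    intro a ha
    obtain ⟨i, hi, rfl | rfl⟩ := hcov' a ha
    · exact absurd (hor i) (hsymm _ ha)
    · exact ⟨i, hi, rfl⟩

lemma DartCycle.forall_link {c : V → α} {n : ℕ} {d : ℕ → G.Dart} (hd : DartCycle c n d)
    {β : Type*} {q : V → β} {A : Set G.Dart} (hor : (∀ i, d i ∈ A) ∨ ∀ i, (d i).symm ∈ A)
    (hA : ∀ a ∈ A, ∀ b ∈ A, c a.snd = c b.fst → q a.snd = q b.fst) (i : ℕ) :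
    q (d i).snd = q (d (i + 1)).fst := by
  rcases hor with hor | hor
  · exact hA _ (hor i) _ (hor (i + 1)) (hd.link i)
  · exact (hA _ (hor (i + 1)) _ (hor i) (hd.link i).symm).symm

end Rainbow

/-! ### Labellings of the minors -/

section Minors

variable {V α : Type*} {G : SimpleGraph V}

lemma dartCycle_mod {c : V → α} {n : ℕ} {D : ℕ → G.Dart} (hn : 0 < n)
    (hlink : ∀ r, r + 1 < n → c (D r).snd = c (D (r + 1)).fst)
    (hclose : c (D (n - 1)).snd = c (D 0).fst)
    (hfst : ∀ r < n, ∀ s < n, c (D r).fst = c (D s).fst → r = s)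
    (hedge : ∀ r < n, ∀ s < n, (D r).edge = (D s).edge → r = s) :
    DartCycle c n fun i => D (i % n) where
  pos := hn
  periodic i j hij := by
    have : i % n = j % n := hij
    simp only [this]
  link i := by
    have hi := Nat.mod_lt i hn
    rcases Nat.lt_or_ge (i % n + 1) n with h | h
    · have : (i + 1) % n = i % n + 1 := by
        rw [Nat.add_mod, Nat.mod_eq_of_lt (a := 1) (by omega), Nat.mod_eq_of_lt h]
      rw [this, hlink _ h]
    · have h' : i % n + 1 = n := by omega
      have h0 : (i + 1) % n = 0 := by
        rw [← Nat.mod_add_mod, h', Nat.mod_self]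
      rw [h0, ← hclose]
      congr 4
      omega
  fst_inj i j hij := hfst _ (Nat.mod_lt _ hn) _ (Nat.mod_lt _ hn) hij
  edge_inj i j hij := hedge _ (Nat.mod_lt _ hn) _ (Nat.mod_lt _ hn) hij

lemma DartCycle.to_id {c : V → α} {n : ℕ} {d : ℕ → G.Dart} (hd : DartCycle c n d)
    (hl : ∀ i, (d i).snd = (d (i + 1)).fst) : DartCycle id n d :=
  ⟨hd.pos, hd.periodic, hl, fun i j hij => hd.fst_inj i j (congrArg c hij), hd.edge_inj⟩

variable {t : ℕ} {col : V → Fin t} {R : RotationSystem G}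

/-- A cycle of the identified graph whose edges form the boundary of a face runs around it. -/
lemma RotationSystem.IsRainbow.link_and_sum [Finite V] [Fintype G.Dart] (h : R.IsRainbow col) {n : ℕ}
    {d : ℕ → G.Dart} (hd : DartCycle col n d) {f : R.Face} (hf : dartEdges d = R.boundary f)
    {ψ : G.Dart → ℤ} (hψ : ∀ d, ψ d.symm = -ψ d) :
    (∀ i, (d i).snd = (d (i + 1)).fst) ∧
      (∑ i ∈ Finset.range n, ψ (d i) = R.faceSum ψ f ∨
        ∑ i ∈ Finset.range n, ψ (d i) = -R.faceSum ψ f) := by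
  classical
  have hor := hd.orientation (A := {a | R.face a = f})
    (fun a ha b hb => h.eq_of_fst (ha.trans hb.symm))
    (fun a ha b hb => h.eq_of_snd (ha.trans hb.symm))
    (fun i => R.mem_boundary_iff.1 (hf ▸ ⟨i, rfl⟩))
  constructor
  · exact hd.forall_link (q := id) hor fun a ha b hb hab => by
      rw [← h.facePerm_eq_of_link (ha.trans hb.symm) hab]; simp
  · refine hd.sum_eq_or_eq_neg (A := {a | R.face a = f}) ?_ (by simpa using hor) ?_ hψ
    · intro a ha hc
      simp only [Finset.mem_filter, Finset.mem_univ, true_and] at ha hc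
      exact h.face_symm_ne a (hc.trans ha.symm)
    · intro a ha
      rw [hf]
      exact ⟨a, by simpa using ha, rfl⟩

lemma potential_symm {Γ : Type*} [Group Γ] (g : V → Γ) (γ : Γ) {ψ : G.Dart → ℤ}
    (hψ : ∀ d, ψ d.symm = -ψ d) (d : G.Dart) :
    (g d.symm.fst)⁻¹ * γ ^ ψ d.symm * g d.symm.snd = ((g d.fst)⁻¹ * γ ^ ψ d * g d.snd)⁻¹ := by
  rw [hψ]
  simp [mul_assoc]

/-- The flow runs between the infinite face and `P.face ε`, which is destroyed by the deletion.
Exponents are `0` or `±1`, so any `γ ≠ 1` serves. -/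
theorem PlaneEmbedding.labellable_delete [Finite V] (P : PlaneEmbedding G)
    (h : P.toRotationSystem.IsRainbow col)
    (hcycle : ∀ (v : V) (w : G.Walk v v), w.IsCycle → w.length ≤ t →
      ∃ f : P.Face, {e | e ∈ w.edges} = P.boundary f)
    (ε : G.Dart) (Γ : Type*) [Group Γ] [Infinite Γ] :
    ((G.identifyColours col).deleteEdges {ε.edge}).Labellable
      (Graph.deleteBalanced P.finiteFaces ε.edge) Γ := by
  classical
  have := Fintype.ofFinite G.Dart
  obtain ⟨ψ, hψ, hs⟩ := P.exists_flow h.connected (P.face ε) P.outer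
  obtain ⟨γ, hγ⟩ := exists_ne (1 : Γ)
  obtain ⟨g, hg⟩ := exists_generic_potential (G := G) col id (fun _ _ => congrArg col) γ ψ
  have hK := (isIdentification_ofSimpleGraph_map (G := G) col).deleteEdges {ε.edge}
  refine hK.labellable (ℓ := fun d => (g d.fst)⁻¹ * γ ^ ψ d * g d.snd)
    (potential_symm g γ hψ) ?_ ?_
  · rintro _ ⟨⟨f, hf, rfl⟩, he⟩
    refine h.isCycleSet_boundary hK ?_
    rintro e' he' rfl
    exact he he'
  · intro n d hd hX
    have hsum : ∀ f, ε.edge ∉ P.boundary f → P.faceSum ψ f = if f = P.outer then -1 else 0 := by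
      intro f hf
      rw [hs, if_neg]
      · split_ifs <;> simp
      · rintro rfl
        exact hf ⟨ε, rfl, rfl⟩
    have heX : ε.edge ∉ dartEdges d := by
      rintro ⟨i, hi⟩
      exact hX i hi
    refine (hg n d hd).trans ?_
    constructor
    · rintro ⟨hl, hp⟩
      obtain ⟨w, hw, hwl, hwe⟩ := (hd.to_id hl).exists_isCycle
      obtain ⟨f, hf⟩ := hcycle _ w hw (by
        rw [hwl]; simpa using hd.le_card_of_forall_mem Finset.univ fun i => Finset.mem_univ _)
      rw [hwe] at hf
      refine ⟨⟨f, ?_, hf⟩, heX⟩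
      rintro rfl
      have h1 := hsum _ (hf ▸ heX)
      rw [if_pos rfl] at h1
      rcases (h.link_and_sum hd hf hψ).2 with h2 | h2 <;> rw [h2, h1] at hp <;> simp_all
    · rintro ⟨⟨f, hfo, hf⟩, -⟩
      obtain ⟨hl, h2⟩ := h.link_and_sum hd hf hψ
      refine ⟨hl, ?_⟩
      rw [hsum f (hf ▸ heX), if_neg hfo, neg_zero, or_self] at h2
      rw [h2, zpow_zero]

/-- If a cycle of the contracted graph closes up after identification of the ends of the
contracted edge, then it either is a cycle of `G` or becomes one by adding that edge. -/
lemma DartCycle.exists_insert {c : V → α} {n : ℕ} {d : ℕ → G.Dart} (hd : DartCycle c n d)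
    {ε : G.Dart} (hε : c ε.fst = c ε.snd) (hX : ∀ i, (d i).edge ≠ ε.edge)
    (hq : ∀ i, (d i).snd = (d (i + 1)).fst ∨ ((d i).snd = ε.fst ∧ (d (i + 1)).fst = ε.snd) ∨
      ((d i).snd = ε.snd ∧ (d (i + 1)).fst = ε.fst)) :
    DartCycle id n d ∨ ∃ D, DartCycle (G := G) id (n + 1) D ∧
      dartEdges D = insert ε.edge (dartEdges d) := by
  by_cases hl : ∀ i, (d i).snd = (d (i + 1)).fst
  · exact Or.inl (hd.to_id hl)
  right
  push Not at hl
  obtain ⟨k, hk⟩ := hl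
  obtain ⟨ε', he', h1, h2⟩ : ∃ ε' : G.Dart, ε'.edge = ε.edge ∧ ε'.fst = (d k).snd ∧
      ε'.snd = (d (k + 1)).fst := by
    rcases (hq k).resolve_left hk with ⟨h1, h2⟩ | ⟨h1, h2⟩
    · exact ⟨ε, rfl, h1.symm, h2.symm⟩
    · exact ⟨ε.symm, by simp, h1.symm, h2.symm⟩
  have hc' : ∀ v, v = ε.fst ∨ v = ε.snd → c v = c (d (k + 1)).fst := by
    rintro v hv
    rcases (hq k).resolve_left hk with ⟨h3, h4⟩ | ⟨h3, h4⟩ <;> rcases hv with rfl | rfl <;>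
      simp [h4, hε]
  -- The cycle is restarted just after the gap at `k`. The merged class is visited once, so there is
  -- no other gap, and the missing dart goes at position `n`.
  set d' : ℕ → G.Dart := fun i => d (i + (k + 1)) with hd'
  have hdc : DartCycle c n d' := hd.shift (k + 1)
  have hn := hd.pos
  have hlast : d' (n - 1) = d k := by
    simp only [hd']
    rw [show n - 1 + (k + 1) = k + n by omega]
    exact hd.periodic _ _ (by simp [Nat.ModEq])
  have h0 : d' 0 = d (k + 1) := by simp [hd']
  have hlink : ∀ r, r + 1 < n → (d' r).snd = (d' (r + 1)).fst := by
    intro r hr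
    have := hq (r + (k + 1))
    rw [show r + (k + 1) + 1 = r + 1 + (k + 1) by omega] at this
    refine this.resolve_right fun hcon => ?_
    have hcc : c (d' (r + 1)).fst = c (d' 0).fst := by
      rw [h0]
      exact hc' _ (by tauto)
    have := DartCycle.eq_of_modEq_of_lt hr hn (hdc.fst_inj _ _ hcc)
    omega
  have hε'c : c ε'.fst = c (d' 0).fst := by
    rw [h0]
    refine hc' _ ?_
    have := (hq k).resolve_left hk
    rw [h1]
    tauto
  let D : ℕ → G.Dart := fun i => if i < n then d' i else ε'
  have hDlt : ∀ i < n, D i = d' i := fun i hi => by simp [D, hi]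
  have hDn : D n = ε' := by simp [D]
  have hcyc : DartCycle id (n + 1) fun i => D (i % (n + 1)) := by
    refine dartCycle_mod (by omega) ?_ ?_ ?_ ?_
    · intro r hr
      rcases Nat.lt_or_ge (r + 1) n with h | h
      · rw [hDlt _ h, hDlt r (by omega)]
        exact hlink r h
      · obtain rfl : n = r + 1 := by omega
        rw [hDn, hDlt r (by omega)]
        simpa [h1] using congrArg (fun x : G.Dart => x.snd) hlast
    · simp only [Nat.add_sub_cancel, hDn, hDlt 0 hn, h0, h2]
    · have hno : ∀ r < n, (d' r).fst ≠ ε'.fst := by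
        intro r hr hcon
        have := DartCycle.eq_of_modEq_of_lt hr hn
          (hdc.fst_inj _ _ ((congrArg c hcon).trans hε'c))
        subst this
        rw [h1, h0] at hcon
        exact hk hcon.symm
      intro r hr s hs hrs
      rcases Nat.lt_or_ge r n with hr' | hr' <;> rcases Nat.lt_or_ge s n with hs' | hs'
      · rw [hDlt r hr', hDlt s hs'] at hrs
        exact DartCycle.eq_of_modEq_of_lt hr' hs' (hdc.fst_inj _ _ (congrArg c hrs))
      · obtain rfl : s = n := by omega
        rw [hDlt r hr', hDn] at hrs
        exact absurd hrs (hno r hr')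
      · obtain rfl : r = n := by omega
        rw [hDlt s hs', hDn] at hrs
        exact absurd hrs.symm (hno s hs')
      · omega
    · intro r hr s hs hrs
      rcases Nat.lt_or_ge r n with hr' | hr' <;> rcases Nat.lt_or_ge s n with hs' | hs'
      · rw [hDlt r hr', hDlt s hs'] at hrs
        exact DartCycle.eq_of_modEq_of_lt hr' hs' (hdc.edge_inj _ _ hrs)
      · obtain rfl : s = n := by omega
        rw [hDlt r hr', hDn, he'] at hrs
        exact absurd hrs (hX _)
      · obtain rfl : r = n := by omega
        rw [hDlt s hs', hDn, he'] at hrs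
        exact absurd hrs.symm (hX _)
      · omega
  refine ⟨_, hcyc, ?_⟩
  rw [← hd.dartEdges_shift (k + 1), hcyc.dartEdges_eq_image, hdc.dartEdges_eq_image]
  ext e
  simp only [Set.mem_image, Set.mem_Iio, Set.mem_insert_iff]
  constructor
  · rintro ⟨i, hi, rfl⟩
    rw [Nat.mod_eq_of_lt hi]
    rcases Nat.lt_or_ge i n with h | h
    · exact Or.inr ⟨i, h, by rw [hDlt i h]⟩
    · obtain rfl : i = n := by omega
      exact Or.inl (by rw [hDn, he'])
  · rintro (rfl | ⟨i, hi, rfl⟩)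
    · exact ⟨n, by omega, by rw [Nat.mod_eq_of_lt (by omega), hDn, he']⟩
    · exact ⟨i, by omega, by rw [Nat.mod_eq_of_lt (by omega), hDlt i hi]⟩

/-- A function on darts that vanishes on the faces at a given edge, except for the infinite
one. -/
lemma PlaneEmbedding.exists_flow_avoiding [Finite V] [Fintype G.Dart] (P : PlaneEmbedding G)
    (h : P.toRotationSystem.IsRainbow col) (ε : G.Dart) :
    ∃ ψ : G.Dart → ℤ, (∀ d, ψ d.symm = -ψ d) ∧ ψ ε = 0 ∧
      ∀ f, ε.edge ∈ P.boundary f → P.faceSum ψ f = open Classical in if f = P.outer then 1 else 0 := by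
  classical
  wlog hε : P.face ε = P.outer generalizing ε
  · by_cases hε' : P.face ε.symm = P.outer
    · obtain ⟨ψ, h1, h2, h3⟩ := this ε.symm hε'
      refine ⟨ψ, h1, ?_, fun f hf => h3 f (by simpa using hf)⟩
      rw [h1] at h2
      simpa using h2
    · refine ⟨fun _ => 0, by simp, rfl, fun f hf => ?_⟩
      rw [if_neg, RotationSystem.faceSum, Finset.sum_const_zero]
      rintro rfl
      rcases P.mem_boundary_iff.1 hf with h1 | h1
      · exact hε h1
      · exact hε' h1
  have hne := h.face_symm_ne ε
  -- The two faces at `ε` have different boundaries of equal size `t`. One unit across an edge of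
  -- the infinite face missing from the other face gives the required sums.
  obtain ⟨e₀, ⟨d₀, hd₀, rfl⟩, he₀⟩ : ∃ e₀ ∈ P.boundary P.outer, e₀ ∉ P.boundary (P.face ε.symm) := by
    by_contra! hcon
    have hsub : P.boundary P.outer ⊆ P.boundary (P.face ε.symm) := hcon
    have := Set.eq_of_subset_of_ncard_le hsub
      (by rw [h.ncard_boundary, h.ncard_boundary]) (Set.toFinite _)
    exact hne ((h.boundary_injective this).symm.trans hε.symm)
  refine ⟨fun x => (if x = d₀ then 1 else 0) - if x = d₀.symm then 1 else 0, ?_, ?_, ?_⟩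
  · intro x
    have h1 : x.symm = d₀ ↔ x = d₀.symm := ⟨fun h => by rw [← h]; simp, fun h => by rw [h]; simp⟩
    have h2 : x.symm = d₀.symm ↔ x = d₀ := SimpleGraph.Dart.symm_involutive.injective.eq_iff
    simp only [h1, h2]
    ring
  · have hee : ε.edge ≠ d₀.edge := fun hc => he₀ (hc ▸ P.mem_boundary_iff.2 (Or.inr rfl))
    simp only
    rw [if_neg, if_neg, sub_zero]
    · rintro rfl
      simp at hee
    · rintro rfl
      exact hee rfl
  · intro f hf
    rw [RotationSystem.faceSum, Finset.sum_sub_distrib]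
    simp only [Finset.sum_ite_eq', Finset.mem_filter, Finset.mem_univ, true_and]
    rcases P.mem_boundary_iff.1 hf with rfl | rfl
    · rw [hε, if_pos hd₀, if_pos rfl, if_neg, sub_zero]
      rw [← hd₀]
      exact h.face_symm_ne d₀
    · rw [if_neg, if_neg, if_neg (fun hc => hne (hc.trans hε.symm)), sub_zero]
      · exact fun hc => he₀ (P.mem_boundary_iff.2 (Or.inr hc))
      · exact fun hc => he₀ (P.mem_boundary_iff.2 (Or.inl hc))

/-- A face boundary avoiding `ε` has `t` edges, too many for a cycle on the `t - 1` remaining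
vertices. So only faces at `ε` yield balanced cycles, and `ψ` need only be controlled there. -/
theorem PlaneEmbedding.labellable_contract [Finite V] (P : PlaneEmbedding G)
    (h : P.toRotationSystem.IsRainbow col)
    (hcycle : ∀ (v : V) (w : G.Walk v v), w.IsCycle → w.length ≤ t →
      ∃ f : P.Face, {e | e ∈ w.edges} = P.boundary f)
    (ε : G.Dart) (Γ : Type*) [Group Γ] [Infinite Γ] :
    ((G.identifyColours col).contract ε.edge (col ε.fst) (col ε.snd)).Labellable
      ((G.identifyColours col).contractBalanced P.finiteFaces ε.edge (col ε.fst) (col ε.snd))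
      Γ := by
  classical
  have := Fintype.ofFinite G.Dart
  obtain ⟨ψ, hψ, hψε, hs⟩ := P.exists_flow_avoiding h ε
  obtain ⟨γ, hγ⟩ := exists_ne (1 : Γ)
  set m : Fin t → Fin t := fun z => if z = col ε.snd then col ε.fst else z with hm
  set c : V → Fin t := m ∘ col with hc
  set q : V → V := fun v => if v = ε.snd then ε.fst else v with hqdef
  have hxy := h.col_fst_ne ε
  have hmm : ∀ s s', m s = m s' → s = s' ∨
      ((s = col ε.fst ∨ s = col ε.snd) ∧ (s' = col ε.fst ∨ s' = col ε.snd)) := by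
    intro s s' hss
    simp only [hm] at hss
    grind
  have hcε : c ε.fst = c ε.snd := by simp [hc, hm, hxy]
  have hcq : ∀ v, c (q v) = c v := by
    intro v
    by_cases hv : v = ε.snd
    · simp [hqdef, hv, hcε]
    · simp [hqdef, hv]
  have hqq : ∀ a b, q a = q b ↔ a = b ∨ (a = ε.fst ∧ b = ε.snd) ∨ (a = ε.snd ∧ b = ε.fst) := by
    intro a b
    simp only [hqdef]
    grind
  obtain ⟨g, hg⟩ := exists_generic_potential (G := G) c q
    (fun a b hab => by rw [← hcq a, hab, hcq]) γ ψ
  have hK : IsIdentification ((G.identifyColours col).contract ε.edge (col ε.fst) (col ε.snd))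
      G c {ε.edge} := by
    have := ((isIdentification_ofSimpleGraph_map (G := G) col).deleteEdges {ε.edge}).map m
    convert this using 1
    simp only [Graph.contract, SimpleGraph.identifyColours, hm]
    congr!
  refine hK.labellable (ℓ := fun d => (g (q d.fst))⁻¹ * γ ^ ψ d * g (q d.snd))
    (potential_symm (fun v => g (q v)) γ hψ) (fun C hC => hC.1) ?_
  intro n d hd hX
  have hX' : ∀ i, (d i).edge ≠ ε.edge := fun i hi => hX i hi
  -- The colour of `ε.snd` has been merged away.
  have hn : n < t := by
    have := hd.le_card_of_forall_mem (Finset.univ.erase (col ε.snd)) fun i => by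
      simp only [Finset.mem_erase, Finset.mem_univ, and_true, hc, Function.comp, hm]
      grind
    rw [Finset.card_erase_of_mem (Finset.mem_univ _), Finset.card_univ, Fintype.card_fin] at this
    have := (col ε.snd).pos
    omega
  -- the cycles that bound a face together with the contracted edge
  have hface : ∀ f, insert ε.edge (dartEdges d) = P.boundary f →
      (∀ i, q (d i).snd = q (d (i + 1)).fst) ∧
      (∑ i ∈ Finset.range n, ψ (d i) = P.faceSum ψ f ∨
        ∑ i ∈ Finset.range n, ψ (d i) = -P.faceSum ψ f) := by
    intro f hf
    obtain ⟨ε', hε'f, hε'⟩ : ε.edge ∈ P.boundary f := hf ▸ Set.mem_insert _ _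
    have hends : (ε'.fst = ε.fst ∧ ε'.snd = ε.snd) ∨ (ε'.fst = ε.snd ∧ ε'.snd = ε.fst) := by
      rcases (SimpleGraph.dart_edge_eq_iff _ _).1 hε' with rfl | rfl
      · exact Or.inl ⟨rfl, rfl⟩
      · exact Or.inr ⟨rfl, rfl⟩
    have hψε' : ψ ε' = 0 := by
      rcases (SimpleGraph.dart_edge_eq_iff _ _).1 hε' with rfl | rfl
      · exact hψε
      · rw [hψ, hψε, neg_zero]
    have hmm' : ∀ s s', m s = m s' → s = s' ∨
        ((s = col ε'.fst ∨ s = col ε'.snd) ∧ (s' = col ε'.fst ∨ s' = col ε'.snd)) := by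
      intro s s' hss
      rcases hends with ⟨h1, h2⟩ | ⟨h1, h2⟩ <;> rw [h1, h2] <;> have := hmm s s' hss <;> tauto
    -- Without `ε'`, no dart of the face starts in the colour of `ε'.fst` or ends in that of
    -- `ε'.snd`, so initial and terminal colours stay distinct after the merging.
    set A : Set G.Dart := {a | P.face a = f ∧ a ≠ ε'} with hA
    have hfst : ∀ a ∈ A, col a.fst ≠ col ε'.fst := fun a ha hcon =>
      ha.2 (h.eq_of_fst (ha.1.trans hε'f.symm) hcon)
    have hsnd : ∀ a ∈ A, col a.snd ≠ col ε'.snd := fun a ha hcon =>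
      ha.2 (h.eq_of_snd (ha.1.trans hε'f.symm) hcon)
    have hdA : ∀ i, d i ∈ A ∨ (d i).symm ∈ A := by
      intro i
      have hi : (d i).edge ∈ P.boundary f := hf ▸ Set.mem_insert_of_mem _ ⟨i, rfl⟩
      have hne : (d i).edge ≠ ε'.edge := fun hcon => hX' i (hcon.trans hε')
      rcases P.mem_boundary_iff.1 hi with h1 | h1
      · exact Or.inl ⟨h1, fun hcon => hne (by rw [hcon])⟩
      · exact Or.inr ⟨h1, fun hcon => hne (by rw [← hcon]; simp)⟩
    have hor := hd.orientation (A := A)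
      (fun a ha b hb hab => h.eq_of_fst (ha.1.trans hb.1.symm) (by
        have h1 := hfst a ha
        have h2 := hfst b hb
        have := hmm' _ _ hab
        grind))
      (fun a ha b hb hab => h.eq_of_snd (ha.1.trans hb.1.symm) (by
        have h1 := hsnd a ha
        have h2 := hsnd b hb
        have := hmm' _ _ hab
        grind)) hdA
    constructor
    · refine hd.forall_link hor fun a ha b hb hab => ?_
      rw [hqq]
      by_cases hcol : col a.snd = col b.fst
      · left
        rw [← h.facePerm_eq_of_link (ha.1.trans hb.1.symm) hcol, P.facePerm_fst]
      · right
        have h1 := hsnd a ha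
        have h2 := hfst b hb
        have := (hmm' _ _ hab).resolve_left hcol
        -- At the only junction of different colours, `ε'` is the omitted dart between `a` and `b`.
        have h3 : a.snd = ε'.fst := by
          rw [← h.facePerm_eq_of_link (ha.1.trans hε'f.symm) (this.1.resolve_right h1),
            P.facePerm_fst]
        have h4 : b.fst = ε'.snd := by
          rw [← h.facePerm_eq_of_link (hε'f.trans hb.1.symm) (this.2.resolve_left h2).symm,
            P.facePerm_fst]
        rw [h3, h4]
        tauto
    · have hsum : P.faceSum ψ f = ∑ a with P.face a = f ∧ a ≠ ε', ψ a := by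
        rw [RotationSystem.faceSum]
        symm
        refine Finset.sum_subset (fun a ha => ?_) (fun a ha hna => ?_)
        · simp only [Finset.mem_filter, Finset.mem_univ, true_and] at ha ⊢
          exact ha.1
        · simp only [Finset.mem_filter, Finset.mem_univ, true_and, ne_eq] at ha hna
          have : a = ε' := by tauto
          rw [this, hψε']
      rw [hsum]
      refine hd.sum_eq_or_eq_neg ?_ (by simpa [hA] using hor) ?_ hψ
      · intro a ha hcon
        simp only [Finset.mem_filter, Finset.mem_univ, true_and] at ha hcon
        exact h.face_symm_ne a (hcon.1.trans ha.1.symm)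
      · intro a ha
        simp only [Finset.mem_filter, Finset.mem_univ, true_and] at ha
        have : a.edge ∈ insert ε.edge (dartEdges d) := hf ▸ ⟨a, ha.1, rfl⟩
        refine this.resolve_left fun hcon => ha.2 ?_
        exact h.eq_of_edge_eq (ha.1.trans hε'f.symm) (hcon.trans hε'.symm)
  refine (hg n d hd).trans ?_
  constructor
  · rintro ⟨hl, hp⟩
    refine ⟨hd.isCycleSet hK hX, Or.inr ?_⟩
    rcases hd.exists_insert hcε hX' (fun i => (hqq _ _).1 (hl i)) with hid | ⟨D, hD, hDe⟩
    -- A cycle of `G` of length `n < t` would bound a face, but face boundaries have `t` edges.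
    · obtain ⟨w, hw, hwl, hwe⟩ := hid.exists_isCycle
      obtain ⟨f, hf⟩ := hcycle _ w hw (by omega)
      have h1 := h.ncard_boundary f
      rw [← hf, hwe, hd.ncard_dartEdges] at h1
      omega
    · obtain ⟨w, hw, hwl, hwe⟩ := hD.exists_isCycle
      obtain ⟨f, hf⟩ := hcycle _ w hw (by omega)
      rw [hwe, hDe] at hf
      refine ⟨f, ?_, hf⟩
      rintro rfl
      have h1 := hs _ (hf ▸ Set.mem_insert _ _)
      rw [if_pos rfl] at h1
      rcases (hface _ hf).2 with h2 | h2 <;> rw [h2, h1] at hp <;> simp_all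
  · rintro ⟨-, ⟨f, hfo, hf⟩ | ⟨f, hfo, hf⟩⟩
    · have h1 := h.ncard_boundary f
      rw [← hf, hd.ncard_dartEdges] at h1
      omega
    · obtain ⟨hl, h2⟩ := hface f hf
      refine ⟨hl, ?_⟩
      rw [hs f (hf ▸ Set.mem_insert _ _), if_neg hfo, neg_zero, or_self] at h2
      rw [h2, zpow_zero]

end Minors

/-! ### Labellings of plane graphs in which all finite faces are balanced -/

section Potential

lemma SimpleGraph.Connected.exists_adj_dist_lt {X : Type*} {D : SimpleGraph X} (hD : D.Connected)
    {x r : X} (hx : x ≠ r) : ∃ y, D.Adj x y ∧ D.dist y r < D.dist x r := by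
  obtain ⟨p, hp⟩ := hD.exists_walk_length_eq_dist x r
  cases p with
  | nil => exact absurd rfl hx
  | cons hadj p =>
    refine ⟨_, hadj, ?_⟩
    have := SimpleGraph.dist_le p
    rw [SimpleGraph.Walk.length_cons] at hp
    omega

lemma induction_rank_descending {X : Type*} [Finite X] (rk : X → ℕ) {p : X → Prop}
    (h : ∀ x, (∀ y, rk x < rk y → p y) → p x) (x : X) : p x := by
  have : IsTrans X fun y x => rk x < rk y := ⟨fun _ _ _ h1 h2 => lt_trans h2 h1⟩
  have : Std.Irrefl fun y x : X => rk x < rk y := ⟨fun _ => lt_irrefl _⟩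
  exact (Finite.wellFounded_of_trans_of_irrefl (fun y x : X => rk x < rk y)).induction x h

lemma exists_rank_recursion {X Γ : Type*} [Inhabited Γ] (rk : X → ℕ) (r : X) (p : X → X)
    (hp : ∀ x, x ≠ r → rk (p x) < rk x) (F : X → Γ → Γ) :
    ∃ h : X → Γ, ∀ x, x ≠ r → h x = F x (h (p x)) := by
  classical
  refine ⟨(measure rk).wf.fix fun x ih =>
    if hx : x ≠ r then F x (ih (p x) (hp x hx)) else default, fun x hx => ?_⟩
  rw [WellFounded.fix_eq, dif_pos hx]

variable {V : Type*} {G : SimpleGraph V}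

/-- Serves both the spanning tree and the dual tree: if two elements shared a parent edge, each
would be the parent of the other. -/
lemma parent_edge_injective {X : Type*} {r : X} {rk : X → ℕ} {side : G.Dart → X}
    {par : {x // x ≠ r} → G.Dart} (hside : ∀ x, side (par x) = x)
    (hrk : ∀ x, rk (side (par x).symm) < rk x) :
    Function.Injective fun x => (par x).edge := by
  intro x y hxy
  rcases (SimpleGraph.dart_edge_eq_iff _ _).1 hxy with h | h
  · exact Subtype.ext (by rw [← hside, h, hside])
  · have h1 := hrk x
    have h2 := hrk y
    rw [h, SimpleGraph.Dart.symm_symm, hside] at h1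
    rw [← h, hside] at h2
    omega

/-- If the edges whose two sides are not both inside or both outside of a set `X` of faces belong
to a tree, given by the darts from the vertices to their parents, then `X` is closed under
crossing edges. -/
lemma RotationSystem.face_mem_iff_of_tree [Finite V] (R : RotationSystem G) {r : V} {rk : V → ℕ}
    {par : {v // v ≠ r} → G.Dart} (hfst : ∀ v, (par v).fst = v)
    (hrk : ∀ v, rk (par v).snd < rk v) {X : Set R.Face}
    (hX : ∀ d : G.Dart, (∀ v, d.edge ≠ (par v).edge) → (R.face d ∈ X ↔ R.face d.symm ∈ X))
    (d : G.Dart) : R.face d ∈ X ↔ R.face d.symm ∈ X := by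
  suffices ∀ v : V, ∀ d : G.Dart, d.fst = v → (R.face d ∈ X ↔ R.face d.symm ∈ X) from
    this d.fst d rfl
  -- The tree is pruned from its deepest vertices. At `v` only the dart to the parent is undecided,
  -- and going around `v` through the other darts decides it.
  refine induction_rank_descending rk fun v ih => ?_
  have hother : ∀ d : G.Dart, d.fst = v → (∀ hv : v ≠ r, d ≠ par ⟨v, hv⟩) →
      (R.face d ∈ X ↔ R.face d.symm ∈ X) := by
    intro d hd hne
    by_cases hT : ∀ v, d.edge ≠ (par v).edge
    · exact hX d hT
    · push Not at hT
      obtain ⟨w, hw⟩ := hT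
      rcases (SimpleGraph.dart_edge_eq_iff _ _).1 hw with rfl | rfl
      · obtain rfl : (w : V) = v := (hfst w).symm.trans hd
        exact absurd rfl (hne w.2)
      · have h1 := hrk w
        rw [show (par w).snd = v from hd] at h1
        rw [SimpleGraph.Dart.symm_symm]
        exact (ih w h1 (par w) (hfst w)).symm
  intro d hd
  by_cases hπ : ∃ hv : v ≠ r, d = par ⟨v, hv⟩
  · obtain ⟨hv, hdπ⟩ := hπ
    rw [← R.face_next]
    refine R.rotation_induction (p := fun x => R.face x ∈ X ↔ R.face (R.next d) ∈ X)
      (d := R.next d) Iff.rfl ?_ (R.fst_next d).symm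
    intro x hx hpx
    by_cases hxd : x = d
    · rw [hxd]
    · rw [R.face_next, ← hother x (by rw [hx, R.fst_next, hd]) (fun _ => by rwa [← hdπ]), hpx]
  · push Not at hπ
    exact hother d hd hπ

/-- A labelling of a plane graph for which all finite faces are balanced is given by a
potential. -/
lemma PlaneEmbedding.exists_potential [Finite V] (P : PlaneEmbedding G) {Γ : Type*} [Group Γ]
    {ℓ : G.Dart → Γ} (hℓ : ∀ d, ℓ d.symm = (ℓ d)⁻¹)
    (hfin : ∀ f, f ≠ P.outer → ∃ n d, DartCycle (G := G) id n d ∧ dartEdges d = P.boundary f ∧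
      rangeProd (fun i => ℓ (d i)) n = 1) :
    ∃ g : V → Γ, ∀ d, ℓ d = (g d.fst)⁻¹ * g d.snd := by
  classical
  -- a spanning tree
  obtain ⟨r⟩ := P.connected.nonempty
  set rk : V → ℕ := fun v => G.dist v r
  have hpar : ∀ v : {v // v ≠ r}, ∃ d : G.Dart, d.fst = v ∧ rk d.snd < rk v := by
    rintro ⟨v, hv⟩
    obtain ⟨w, hadj, hw⟩ := P.connected.exists_adj_dist_lt hv
    exact ⟨⟨(v, w), hadj⟩, rfl, hw⟩
  choose par hfst hrk using hpar
  have hpinj := parent_edge_injective (side := fun d : G.Dart => d.fst) hfst hrk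
  -- the dual graph without the edges of the tree is connected
  let D : SimpleGraph P.Face :=
    { Adj := fun f f' => f ≠ f' ∧ ∃ d : G.Dart, (∀ v, d.edge ≠ (par v).edge) ∧
        P.face d = f ∧ P.face d.symm = f'
      symm := ⟨by
        rintro f f' ⟨hne, d, hd, h1, h2⟩
        exact ⟨hne.symm, d.symm, by simpa using hd, h2, by simpa using h1⟩⟩
      loopless := ⟨fun f h => h.1 rfl⟩ }
  have hD : D.Connected := by
    have hreach : ∀ f, D.Reachable P.outer f := by
      refine P.face_mem_of_closed P.connected (X := {f | D.Reachable P.outer f})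
        (f := P.outer) (SimpleGraph.Reachable.refl _) fun d =>
          (P.face_mem_iff_of_tree hfst hrk (X := {f | D.Reachable P.outer f}) ?_ d).1
      intro d hd
      have hdd : D.Reachable (P.face d) (P.face d.symm) := by
        by_cases hne : P.face d = P.face d.symm
        · rw [← hne]
        · exact SimpleGraph.Adj.reachable ⟨hne, d, hd, rfl, rfl⟩
      exact ⟨fun h => h.trans hdd, fun h => h.trans hdd.symm⟩
    exact SimpleGraph.connected_iff _ |>.2
      ⟨fun f f' => (hreach f).symm.trans (hreach f'), ⟨P.outer⟩⟩
  set rkF : P.Face → ℕ := fun f => D.dist f P.outer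
  have hdual : ∀ f : {f // f ≠ P.outer}, ∃ d : G.Dart, P.face d = f ∧
      rkF (P.face d.symm) < rkF f ∧ ∀ v, d.edge ≠ (par v).edge := by
    rintro ⟨f, hf⟩
    obtain ⟨f', ⟨-, d, hd, h1, rfl⟩, hlt⟩ := hD.exists_adj_dist_lt hf
    exact ⟨d, h1, hlt, hd⟩
  choose δ hδf hδrk hδT using hdual
  have hδinj := parent_edge_injective (side := P.face) hδf hδrk
  -- every edge belongs to the tree or joins a finite face to its parent
  have hsurj : Function.Surjective (Sum.elim (fun v => (⟨(par v).edge, (par v).edge_mem⟩ :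
      G.edgeSet)) fun f => (⟨(δ f).edge, (δ f).edge_mem⟩ : G.edgeSet)) := by
    -- Euler's formula reads `(|V| - 1) + (|F| - 1) = |E|`, so injectivity suffices.
    refine (Function.Injective.bijective_of_nat_card_le ?_ ?_).2
    · rintro (v | f) (w | f') hvw <;> simp only [Sum.elim_inl, Sum.elim_inr, Subtype.mk.injEq] at hvw
      · rw [hpinj hvw]
      · exact absurd hvw.symm (hδT _ _)
      · exact absurd hvw (hδT _ _)
      · rw [hδinj hvw]
    · have hcard : ∀ {X : Type _} [Finite X] (x : X), Nat.card {y // y ≠ x} + 1 = Nat.card X := by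
        intro X _ x
        have := Fintype.ofFinite X
        rw [Nat.card_eq_fintype_card, Nat.card_eq_fintype_card, Fintype.card_subtype_compl]
        have : 0 < Fintype.card X := Fintype.card_pos_iff.2 ⟨x⟩
        simp
        omega
      have heuler : Nat.card V + Nat.card P.Face = Nat.card {e // e ∈ G.edgeSet} + 2 := P.euler
      have h1 := hcard r
      have h2 := hcard P.outer
      rw [Nat.card_sum]
      omega
  have hcover : ∀ d : G.Dart, (∃ v, d = par v ∨ d = (par v).symm) ∨
      ∃ f, d = δ f ∨ d = (δ f).symm := by
    intro d
    obtain ⟨v | f, hv⟩ := hsurj ⟨d.edge, d.edge_mem⟩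
    · exact Or.inl ⟨v, (SimpleGraph.dart_edge_eq_iff _ _).1 (congrArg Subtype.val hv).symm⟩
    · exact Or.inr ⟨f, (SimpleGraph.dart_edge_eq_iff _ _).1 (congrArg Subtype.val hv).symm⟩
  -- a potential for the tree
  obtain ⟨g, hg⟩ : ∃ g : V → Γ, ∀ v : {v // v ≠ r}, g v = g (par v).snd * (ℓ (par v))⁻¹ := by
    have : Inhabited Γ := ⟨1⟩
    obtain ⟨g, hg⟩ := exists_rank_recursion rk r
      (fun v => if hv : v ≠ r then (par ⟨v, hv⟩).snd else v)
      (fun v hv => by rw [dif_pos hv]; exact hrk ⟨v, hv⟩)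
      (fun v x => if hv : v ≠ r then x * (ℓ (par ⟨v, hv⟩))⁻¹ else (1 : Γ))
    refine ⟨g, fun v => ?_⟩
    have := hg v v.2
    rwa [dif_pos v.2, dif_pos v.2] at this
  -- The labelling switched by `g`, trivial on the tree; finite faces keep trivial value.
  set ℓ' : G.Dart → Γ := fun d => g d.fst * ℓ d * (g d.snd)⁻¹ with hℓ'
  have hℓ's : ∀ d, ℓ' d = 1 → ℓ' d.symm = 1 := by
    intro d hd
    have : ℓ' d.symm = (ℓ' d)⁻¹ := by simp [hℓ', hℓ, mul_assoc]
    rw [this, hd, inv_one]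
  have htree : ∀ v, ℓ' (par v) = 1 := by
    intro v
    simp only [hℓ']
    rw [hfst, hg]
    simp
  -- Farthest faces first: on `f` every edge but the one to its parent already has trivial label, so
  -- the trivial product forces the last one.
  have hdualtriv : ∀ f (hf : f ≠ P.outer), ℓ' (δ ⟨f, hf⟩) = 1 := by
    refine induction_rank_descending rkF fun f ih hf => ?_
    obtain ⟨n, d, hd, hde, hdp⟩ := hfin f hf
    have hprod : rangeProd (fun i => ℓ' (d i)) n = rangeProd (fun _ => 1) n := by
      have h1 := rangeProd_regroup (fun i => (g (d i).fst)⁻¹) (fun i => (g (d i).snd)⁻¹)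
        (fun i => ℓ (d i)) n
      simp only [inv_inv] at h1
      simp only [hℓ']
      rw [h1, hd.apply_period, rangeProd_congr (F' := fun i => ℓ (d i)), hdp, rangeProd_one]
      · simp
      · intro i _
        rw [show (d i).snd = (d (i + 1)).fst from hd.link i]
        simp
    obtain ⟨j, hj, hje⟩ : ∃ j < n, (d j).edge = (δ ⟨f, hf⟩).edge := by
      have : (δ ⟨f, hf⟩).edge ∈ dartEdges d := hde ▸ ⟨_, hδf _, rfl⟩
      rw [hd.dartEdges_eq_image] at this
      exact this
    have hnontree : ∀ x : G.Dart, P.face x = f → x.edge ≠ (δ ⟨f, hf⟩).edge → ℓ' x = 1 := by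
      intro x hx hne
      rcases hcover x with ⟨v, rfl | rfl⟩ | ⟨f', rfl | rfl⟩
      · exact htree v
      · exact hℓ's _ (htree v)
      · have : f' = ⟨f, hf⟩ := Subtype.ext ((hδf f').symm.trans hx)
        exact absurd (by rw [this]) hne
      · refine hℓ's _ (ih f' ?_ f'.2)
        rw [← hx]
        exact hδrk f'
    have hdj := eq_of_rangeProd_eq hj (fun i hi hij => by
      have hne : (d i).edge ≠ (δ ⟨f, hf⟩).edge := fun hcon =>
        hij (DartCycle.eq_of_modEq_of_lt hi hj (hd.edge_inj _ _ (hcon.trans hje.symm)))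
      have hb : (d i).edge ∈ P.boundary f := hde ▸ ⟨i, rfl⟩
      rcases P.mem_boundary_iff.1 hb with h1 | h1
      · exact hnontree _ h1 hne
      · have := hℓ's _ (hnontree _ h1 (by simpa using hne))
        simpa using this) hprod
    rcases (SimpleGraph.dart_edge_eq_iff _ _).1 hje with h1 | h1
    · rwa [h1] at hdj
    · rw [h1] at hdj
      simpa using hℓ's _ hdj
  have hall : ∀ d, ℓ' d = 1 := by
    intro d
    rcases hcover d with ⟨v, rfl | rfl⟩ | ⟨f', rfl | rfl⟩
    · exact htree v
    · exact hℓ's _ (htree v)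
    · exact hdualtriv f' f'.2
    · exact hℓ's _ (hdualtriv f' f'.2)
  refine ⟨g, fun d => ?_⟩
  have := hall d
  simp only [hℓ'] at this
  rw [mul_inv_eq_one] at this
  rw [← this]
  simp

/-- A potential makes the infinite face balanced, although its boundary is not that of any finite
face. -/
theorem PlaneEmbedding.not_labellable [Finite V] {t : ℕ} {col : V → Fin t} (P : PlaneEmbedding G)
    (h : P.toRotationSystem.IsRainbow col) (Γ : Type*) [Group Γ] :
    ¬ (G.identifyColours col).Labellable P.finiteFaces Γ := by
  classical
  rintro ⟨φ, hφ⟩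
  have hK : IsIdentification (G.identifyColours col) G col ∅ :=
    isIdentification_ofSimpleGraph_map col
  have hlink : ∀ d : G.Dart, (G.identifyColours col).IsLink d.edge (col d.fst) (col d.snd) :=
    fun d => (hK _ _ _).2 ⟨by simp, d, rfl, rfl, rfl⟩
  let ℓ : G.Dart → Γ := fun d => if col d.fst = φ.tail ⟨d.edge, (hlink d).edge_mem⟩ then
    φ.label ⟨d.edge, (hlink d).edge_mem⟩ else (φ.label ⟨d.edge, (hlink d).edge_mem⟩)⁻¹
  have hℓ : ∀ d, ℓ d.symm = (ℓ d)⁻¹ := by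
    intro d
    have he : (⟨d.symm.edge, (hlink d.symm).edge_mem⟩ : E(G.identifyColours col)) =
        ⟨d.edge, (hlink d).edge_mem⟩ := Subtype.ext (by simp)
    simp only [ℓ, he]
    -- As there are no loops, exactly one of `d` and `d.symm` starts at the tail.
    have hne := h.col_fst_ne d
    obtain ⟨z, hz⟩ := φ.inc_tail ⟨d.edge, (hlink d).edge_mem⟩
    rcases hz.left_eq_or_eq (hlink d) with h1 | h1
    · rw [if_neg, if_pos h1.symm]
      rw [h1]
      exact hne.symm
    · rw [if_pos (show col d.symm.fst = _ from h1.symm), if_neg, inv_inv]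
      rw [h1]
      exact hne
  have hstep : ∀ e u v (h : (G.identifyColours col).IsLink e u v),
      ∃ d : G.Dart, d.edge = e ∧ col d.fst = u ∧ col d.snd = v ∧
      ((u = φ.tail ⟨e, h.edge_mem⟩ → ℓ d = φ.label ⟨e, h.edge_mem⟩) ∧
        (u ≠ φ.tail ⟨e, h.edge_mem⟩ → ℓ d = (φ.label ⟨e, h.edge_mem⟩)⁻¹)) := by
    intro e u v huv
    obtain ⟨-, d, rfl, rfl, rfl⟩ := (hK _ _ _).1 huv
    exact ⟨d, rfl, rfl, rfl, fun hc => if_pos hc, fun hc => if_neg hc⟩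
  have := Fintype.ofFinite G.Dart
  obtain ⟨g, hg⟩ := P.exists_potential hℓ fun f hf => by
    obtain ⟨u, p, hp, hpe, hgain⟩ : P.boundary f ∈ φ.balanced := hφ ▸ ⟨f, hf, rfl⟩
    obtain ⟨n, d, hd, hde, hdp⟩ := hp.exists_dartCycle hstep
    refine ⟨n, d, hd.to_id ?_, hde.trans hpe, hdp.trans hgain⟩
    -- Only the closing up in `G` is needed, so any antisymmetric `ψ` will do.
    exact (h.link_and_sum hd (hde.trans hpe) (ψ := fun _ => 0) (by simp)).1
  have houter : P.boundary P.outer ∈ φ.balanced := by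
    obtain ⟨u, p, hp, hpe⟩ := h.isCycleSet_boundary hK (f := P.outer) (by simp)
    refine ⟨u, p, hp, hpe, ?_⟩
    obtain ⟨n, d, hd, hde, hdp⟩ := hp.exists_dartCycle hstep
    have hl := (h.link_and_sum hd (hde.trans hpe) (ψ := fun _ => 0) (by simp)).1
    rw [← hdp, rangeProd_congr (F' := fun i => (g (d i).fst)⁻¹ * 1 * g (d i).snd)
      (fun i _ => by rw [hg, mul_one]), rangeProd_regroup (fun i => g (d i).fst) _ (fun _ => 1),
      rangeProd_congr (F' := fun _ => 1) (fun i _ => by rw [hl]; simp), rangeProd_one,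
      hd.apply_period]
    simp
  rw [hφ] at houter
  obtain ⟨f, hf, hff⟩ := houter
  exact hf (h.boundary_injective hff).symm

end Potential

/-! ### Theta subgraphs -/

namespace Graph.Walk

variable {α β : Type*} {K : Graph α β}

lemma length_support {u v : α} (p : K.Walk u v) : p.support.length = p.edges.length + 1 := by
  induction p with
  | nil => rfl
  | cons e h p ih => simp [support, edges, ih]

/-- Each support has one vertex more than the path has edges, and the two share at most two. -/
lemma IsPath.length_add_le_card [DecidableEq α] {x y : α} {p q : K.Walk x y} (hp : p.IsPath)
    (hq : q.IsPath) (hpq : p.InternallyDisjoint q) :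
    p.edges.length + q.edges.length ≤ (p.support.toFinset ∪ q.support.toFinset).card := by
  have h1 := Finset.card_union_add_card_inter p.support.toFinset q.support.toFinset
  rw [List.toFinset_card_of_nodup hp, List.toFinset_card_of_nodup hq, length_support,
    length_support] at h1
  have h2 : (p.support.toFinset ∩ q.support.toFinset).card ≤ 2 := by
    refine (Finset.card_le_card (t := {x, y}) fun z hz => ?_).trans Finset.card_le_two
    simp only [Finset.mem_inter, List.mem_toFinset] at hz
    simpa using hpq.2 z hz.1 hz.2
  omega

/-- A path whose vertices are only its two ends is a single edge. -/
lemma IsPath.exists_edges_eq_singleton {x y : α} (hxy : x ≠ y) {r : K.Walk x y} (hr : r.IsPath)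
    (h : ∀ z ∈ r.support, z = x ∨ z = y) : ∃ e, r.edges = [e] := by
  classical
  have hlen : r.support.length ≤ 2 := by
    rw [← List.toFinset_card_of_nodup hr]
    refine (Finset.card_le_card (t := {x, y}) fun z hz => ?_).trans Finset.card_le_two
    simpa using h z (by simpa using hz)
  rw [length_support] at hlen
  cases r with
  | nil => exact absurd rfl hxy
  | cons e he p =>
    refine ⟨e, ?_⟩
    simp only [edges, List.length_cons] at hlen ⊢
    rw [List.length_eq_zero_iff.1 (by omega : p.edges.length = 0)]

/-- In a theta graph with two spanning cycles, the third path is a single edge. -/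
lemma exists_edges_eq_singleton_of_card_le [Fintype α] {x y : α} (hxy : x ≠ y)
    {p q r : K.Walk x y} (hp : p.IsPath) (hq : q.IsPath) (hr : r.IsPath)
    (hpq : p.InternallyDisjoint q) (hpr : p.InternallyDisjoint r) (hqr : q.InternallyDisjoint r)
    (hcard : Fintype.card α ≤ p.edges.length + q.edges.length) : ∃ e, r.edges = [e] := by
  classical
  have huniv : p.support.toFinset ∪ q.support.toFinset = Finset.univ :=
    (Finset.card_eq_iff_eq_univ _).1 (le_antisymm (Finset.card_le_univ _)
      (hcard.trans (hp.length_add_le_card hq hpq)))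
  refine hr.exists_edges_eq_singleton hxy fun z hz => ?_
  have : z ∈ p.support.toFinset ∪ q.support.toFinset := huniv ▸ Finset.mem_univ z
  simp only [Finset.mem_union, List.mem_toFinset] at this
  rcases this with h | h
  · exact hpr.2 z h hz
  · exact hqr.2 z h hz

lemma ncard_edgeSet_union_le {u v w z : α} (p : K.Walk u v) (q : K.Walk w z) :
    (p.edgeSet ∪ q.edgeSet).ncard ≤ p.edges.length + q.edges.length := by
  classical
  have h : ∀ {u v : α} (p : K.Walk u v), p.edgeSet.ncard ≤ p.edges.length := by
    intro u v p
    have : p.edgeSet = (p.edges.toFinset : Set β) := by ext; simp [edgeSet]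
    rw [this, Set.ncard_coe_finset]
    exact List.toFinset_card_le _
  exact (Set.ncard_union_le _ _).trans (Nat.add_le_add (h p) (h q))

lemma exists_inc_right {u v : α} (huv : u ≠ v) (p : K.Walk u v) : ∃ e ∈ p.edges, K.Inc e v := by
  induction p with
  | nil => exact absurd rfl huv
  | @cons u v w e h p ih =>
    by_cases hvw : v = w
    · subst hvw
      exact ⟨e, by simp [edges], _, h.symm⟩
    · obtain ⟨f, hf, hi⟩ := ih hvw
      exact ⟨f, by simp [edges, hf], hi⟩

lemma exists_inc_left {u v : α} (huv : u ≠ v) (p : K.Walk u v) : ∃ e ∈ p.edges, K.Inc e u := by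
  cases p with
  | nil => exact absurd rfl huv
  | cons e h p => exact ⟨e, by simp [edges], _, h⟩

end Graph.Walk

section Biased

variable {V : Type*} {G : SimpleGraph V}

/-- The theta condition holds vacuously: two balanced cycles sharing `p` would force `q` and `r` to
be single edges with the same ends in `G`. -/
theorem PlaneEmbedding.isBiased [Finite V] {t : ℕ} {col : V → Fin t} (P : PlaneEmbedding G)
    (h : P.toRotationSystem.IsRainbow col) :
    (G.identifyColours col).IsBiased P.finiteFaces := by
  have hK : IsIdentification (G.identifyColours col) G col ∅ :=
    isIdentification_ofSimpleGraph_map col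
  refine ⟨?_, ?_⟩
  · rintro _ ⟨f, -, rfl⟩
    exact h.isCycleSet_boundary hK (by simp)
  · rintro x y p q r hxy hp hq hr hpq hpr hqr ⟨f₁, -, hf₁⟩ ⟨f₂, -, hf₂⟩
    exfalso
    have hlen : ∀ {q : (G.identifyColours col).Walk x y} {f : P.Face},
        p.edgeSet ∪ q.edgeSet = P.boundary f →
        Fintype.card (Fin t) ≤ p.edges.length + q.edges.length := by
      intro q f hf
      have hle := Graph.Walk.ncard_edgeSet_union_le p q
      rw [hf, h.ncard_boundary f] at hle
      exact (Fintype.card_fin t).le.trans hle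
    have hrq : r.InternallyDisjoint q :=
      ⟨fun e he he' => hqr.1 e he' he, fun z hz hz' => hqr.2 z hz' hz⟩
    obtain ⟨e₂, he₂⟩ := Graph.Walk.exists_edges_eq_singleton_of_card_le hxy hp hq hr hpq hpr hqr
      (hlen hf₁)
    obtain ⟨e₁, he₁⟩ := Graph.Walk.exists_edges_eq_singleton_of_card_le hxy hp hr hq hpr hpq hrq
      (hlen hf₂)
    have hne : e₁ ≠ e₂ := by
      rintro rfl
      exact hqr.1 e₁ (by simp [he₁]) (by simp [he₂])
    have hp₁ : e₁ ∉ p.edgeSet := fun hc => hpq.1 e₁ hc (by simp [he₁])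
    have hb₁ : ∀ g, g ∈ P.boundary f₁ ↔ g ∈ p.edgeSet ∨ g = e₁ := by
      intro g
      rw [← hf₁]
      simp [Graph.Walk.edgeSet, he₁, or_comm]
    have hb₂ : ∀ g, g ∈ P.boundary f₂ ↔ g ∈ p.edgeSet ∨ g = e₂ := by
      intro g
      rw [← hf₂]
      simp [Graph.Walk.edgeSet, he₂, or_comm]
    have he₁b : e₁ ∈ P.boundary f₁ := (hb₁ _).2 (Or.inr rfl)
    -- At `v` the edge `e₁` is followed by some `g` in `p`. Around `f₂` the other edge at `v` cannot
    -- lie in `p`, since `e₁` is already the unique partner of `g` around `f₁`; so it is `e₂`.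
    have hends : ∀ v ∈ e₁, v ∈ e₂ := by
      intro v hv
      obtain ⟨g, ⟨hg, hge, hvg⟩, -⟩ := h.existsUnique_boundary he₁b hv
      have hgp : g ∈ p.edgeSet := ((hb₁ g).1 hg).resolve_right hge
      obtain ⟨g', ⟨hg', hge', hvg'⟩, -⟩ :=
        h.existsUnique_boundary ((hb₂ g).2 (Or.inl hgp)) hvg
      rcases (hb₂ g').1 hg' with h1 | rfl
      · have := (h.existsUnique_boundary hg hvg).unique ⟨(hb₁ g').2 (Or.inl h1), hge', hvg'⟩
          ⟨he₁b, hge.symm, hv⟩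
        exact absurd (this ▸ h1) hp₁
      · exact hvg'
    obtain ⟨d, -, rfl⟩ := he₁b
    refine hne (((Sym2.mem_and_mem_iff d.adj.ne).1 ⟨hends _ ?_, hends _ ?_⟩).symm)
    · exact SimpleGraph.Dart.mem_edge_iff.2 (Or.inl rfl)
    · exact SimpleGraph.Dart.mem_edge_iff.2 (Or.inr rfl)

end Biased

/-! ### Vertices of degree three -/

section Degree

variable {α β α' β' : Type*}

/-- A vertex of a 3-connected graph has three neighbours. -/
lemma Graph.IsThreeConnected.exists_three_adj {H : Graph α β} (hH : H.IsThreeConnected) {x : α}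
    (hx : x ∈ V(H)) : ∃ a b c, H.Adj x a ∧ H.Adj x b ∧ H.Adj x c ∧ a ≠ b ∧ a ≠ c ∧ b ≠ c := by
  have := hH.loopless
  suffices hcard : 3 ≤ {y | H.Adj x y}.encard by
    obtain ⟨s, hs, hs3⟩ := Set.exists_subset_encard_eq hcard
    obtain ⟨a, b, c, hab, hac, hbc, rfl⟩ := Set.encard_eq_three.1 hs3
    exact ⟨a, b, c, hs (by simp), hs (by simp), hs (by simp), hab, hac, hbc⟩
  by_contra hlt
  have hle : {y | H.Adj x y}.encard ≤ 2 := by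
    rw [not_le] at hlt
    exact ENat.lt_add_one_iff (by simp) |>.1 (hlt.trans_eq (by norm_num))
  -- With at most two neighbours, deleting them would separate `x` from a fourth vertex.
  obtain ⟨y, hy, hyN⟩ : ∃ y ∈ V(H), y ∉ insert x {y | H.Adj x y} := by
    by_contra! hcon
    have h1 := (Set.encard_le_encard (show V(H) ⊆ insert x {y | H.Adj x y} from hcon)).trans
      (Set.encard_insert_le _ _)
    have h2 := hH.four_le_card.trans (h1.trans (add_le_add_left hle 1))
    norm_num at h2
  simp only [Set.mem_insert_iff, not_or] at hyN
  obtain ⟨p⟩ := hH.connected _ hle x ⟨hx, H.not_adj_self x⟩ y ⟨hy, hyN.2⟩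
  cases p with
  | nil => exact hyN.1 rfl
  | cons e h p =>
    rw [Graph.deleteVerts_isLink] at h
    exact h.2.2 ⟨e, h.1⟩

lemma Graph.Subdivision.exists_inc {G : Graph α β} {H : Graph α' β'} (S : G.Subdivision H)
    [H.Loopless] (f : E(H)) {x : α'} (hx : H.Inc f x) :
    ∃ e ∈ (S.path f).edges, G.Inc e (S.branch x) := by
  have hl := S.isLink f
  have hne : S.branch (S.left f) ≠ S.branch (S.right f) := fun hc =>
    hl.ne (S.branch_injOn hl.left_mem hl.right_mem hc)
  obtain ⟨y, hy⟩ := hx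
  rcases hy.left_eq_or_eq hl with rfl | rfl
  · exact (S.path f).exists_inc_left hne
  · exact (S.path f).exists_inc_right hne

/-- The edges of `H` from `x` to three neighbours are replaced by edge-disjoint paths, each with an
edge at `S.branch x`. -/
lemma Graph.Subdivision.exists_three_darts {G : SimpleGraph α} {H : Graph α' β'}
    (hH : H.IsThreeConnected) (S : (Graph.ofSimpleGraph G).Subdivision H) :
    ∃ a b c : G.Dart, b.fst = a.fst ∧ c.fst = a.fst ∧ a ≠ b ∧ a ≠ c ∧ b ≠ c := by
  have := hH.loopless
  obtain ⟨x, hx⟩ : V(H).Nonempty := by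
    rw [← Set.encard_pos]
    exact lt_of_lt_of_le (by norm_num) hH.four_le_card
  have hdart : ∀ {a f} (hf : H.IsLink f x a), ∃ d : G.Dart, d.fst = S.branch x ∧
      d.edge ∈ (S.path ⟨f, hf.edge_mem⟩).edges := by
    intro a f hf
    obtain ⟨e, he, w, hw⟩ := S.exists_inc ⟨f, hf.edge_mem⟩ ⟨a, hf⟩
    obtain ⟨rfl, hadj⟩ : e = s(S.branch x, w) ∧ e ∈ G.edgeSet := hw
    exact ⟨⟨(_, w), hadj⟩, rfl, he⟩
  have hdist : ∀ {a b f f'} (hf : H.IsLink f x a) (hf' : H.IsLink f' x b), a ≠ b →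
      ∀ d d' : G.Dart, d.edge ∈ (S.path ⟨f, hf.edge_mem⟩).edges →
        d'.edge ∈ (S.path ⟨f', hf'.edge_mem⟩).edges → d ≠ d' := by
    rintro a b f f' hf hf' hab d d' hd hd' rfl
    refine S.edges_disjoint _ _ (fun hc => hab ?_) _ hd hd'
    obtain rfl : f = f' := congrArg Subtype.val hc
    exact hf.right_unique hf'
  obtain ⟨a, b, c, ⟨f₁, h₁⟩, ⟨f₂, h₂⟩, ⟨f₃, h₃⟩, hab, hac, hbc⟩ := hH.exists_three_adj hx
  obtain ⟨d₁, hd₁, he₁⟩ := hdart h₁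
  obtain ⟨d₂, hd₂, he₂⟩ := hdart h₂
  obtain ⟨d₃, hd₃, he₃⟩ := hdart h₃
  exact ⟨d₁, d₂, d₃, hd₂.trans hd₁.symm, hd₃.trans hd₁.symm, hdist h₁ h₂ hab _ _ he₁ he₂,
    hdist h₁ h₃ hac _ _ he₁ he₃, hdist h₂ h₃ hbc _ _ he₂ he₃⟩

end Degree

/-! ### The theorem -/

theorem theorem3p1 {V W F : Type*} [Finite V] {t : ℕ} (G : SimpleGraph V) (P : PlaneEmbedding G)
    (col : V → Fin t)
    -- `G` is a subdivision of a 3-connected graph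
    (H : Graph W F) (hH : H.IsThreeConnected) (S : (Graph.ofSimpleGraph G).Subdivision H)
    -- every colour appears exactly once on (the boundary walk of) every face
    (hface : ∀ (f : P.Face) (c : Fin t), ∃! d : G.Dart, P.face d = f ∧ col d.fst = c)
    -- every cycle of length at most `t` is the boundary of a face
    (hcycle : ∀ (v : V) (w : G.Walk v v), w.IsCycle → w.length ≤ t →
      ∃ f : P.Face, {e | e ∈ w.edges} = P.boundary f) :
    (G.identifyColours col).IsBiased P.finiteFaces ∧
    (∀ (Γ : Type*) [Group Γ], ¬ (G.identifyColours col).Labellable P.finiteFaces Γ) ∧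
    (∀ (e : Sym2 V) (x y : Fin t), (G.identifyColours col).IsLink e x y →
      x ≠ y ∧
      ∀ (Γ : Type*) [Group Γ] [Infinite Γ],
        ((G.identifyColours col).deleteEdges {e}).Labellable
          (Graph.deleteBalanced P.finiteFaces e) Γ ∧
        ((G.identifyColours col).contract e x y).Labellable
          ((G.identifyColours col).contractBalanced P.finiteFaces e x y) Γ) := by
  have h : P.toRotationSystem.IsRainbow col := ⟨P.connected, S.exists_three_darts hH, hface⟩
  refine ⟨P.isBiased h, fun Γ _ => P.not_labellable h Γ, fun e x y hxy => ?_⟩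
  obtain ⟨-, ε, rfl, rfl, rfl⟩ := (isIdentification_ofSimpleGraph_map col _ _ _).1 hxy
  exact ⟨h.col_fst_ne ε, fun Γ _ _ =>
    ⟨P.labellable_delete h hcycle ε Γ, P.labellable_contract h hcycle ε Γ⟩⟩
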